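/- Lemma 2.1 (velocity averaging). Let $d_1,d_2\ge 1$ be integers, let $R,K>0$, and let $B_R\subset\mathbb R^{d_2}$ be the open ball of radius $R$ centred at $0$. Let $\alpha\in(0,1]$ and let $b\in L^\infty\cap H^1(B_R,\mathbb R^{d_1})$ be nondegenerate with exponent $\alpha$ and constant $K$, i.e. $$\big|\{v\in B_R:\ |\mu+b(v)\cdot\nu|\le\epsilon\}\big|\le K\epsilon^\alpha\qquad\text{for all }\mu\in\mathbb R,\ \nu\in\mathbb S^{d_1-1},\ \epsilon>0 .$$ Let $\psi\in C^1_c(B_R)$, and let real-valued $h,g_0\in L^2(\mathbb R_t\times\mathbb R^{d_1}_x\times B_R)$ and $g_1\in L^2(\mathbb R_t\times\mathbb R^{d_1}_x\times B_R,\mathbb R^{d_2})$ satisfy $$(\partial_t+b(v)\cdot\nabla_x)h=\operatorname{div}_v g_1+g_0$$ in the sense of distributions on $\mathbb R\times\mathbb R^{d_1}\times B_R$. Then, with $\varsigma:=\frac{\alpha}{4+\alpha}$, the velocity average $$h_\psi(t,x):=\int_{B_R}h(t,x,v)\,\psi(v)\,dv$$ belongs to $H^\varsigma(\mathbb R_t\times\mathbb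 R^{d_1}_x)$, and $$\|h_\psi\|_{H^\varsigma}\le C_b\,\|\psi\|_{W^{1,\infty}(B_R)}\big(\|h\|_{L^2}+\|g_1\|_{L^2}+\|g_0\|_{L^2}\big),$$ where the $L^2$ norms are over $\mathbb R\times\mathbb R^{d_1}\times B_R$. The constant $C_b>0$ depends only on $d_1,d_2,K,R$ and on upper bounds for $\|b\|_{L^\infty(B_R)}$ and $\|Db\|_{L^2(B_R)}$; in particular it does not depend on $\alpha$. -/

import Mathlib

open MeasureTheory Metric Set
open scoped ENNReal NNReal ContDiff SchwartzMap

/-- The position variable ranges over `ℝ^{d₁}` and the velocity variable over `ℝ^{d₂}`. -/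
abbrev Euc (d : ℕ) : Type := EuclideanSpace ℝ (Fin d)

/-- Space-time `ℝ_t × ℝ^{d₁}_x` with its Euclidean (Hilbert) structure. -/
abbrev SpaceTime (d₁ : ℕ) : Type := WithLp 2 (ℝ × Euc d₁)

/-- The domain `ℝ_t × ℝ^{d₁}_x × B_R`, where `B_R` is the open ball of `ℝ^{d₂}`. -/
def phaseDomain (d₁ d₂ : ℕ) (R : ℝ) : Set (ℝ × Euc d₁ × Euc d₂) :=
  univ ×ˢ univ ×ˢ ball 0 R

/-- `b ∈ H¹(U, ℝ^{d₁})` with weak (distributional) derivative `Db`: both are in `L²(U)`, and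
`∫_U (∂_w φ) b = - ∫_U φ (Db w)` for all `φ ∈ C_c^∞(U)` and all directions `w`. -/
structure HasH1Deriv {d₁ d₂ : ℕ} (U : Set (Euc d₂)) (b : Euc d₂ → Euc d₁)
    (Db : Euc d₂ → Euc d₂ →L[ℝ] Euc d₁) : Prop where
  memLp : MemLp b 2 (volume.restrict U)
  memLp_deriv : MemLp Db 2 (volume.restrict U)
  integral_eq : ∀ φ : Euc d₂ → ℝ, ContDiff ℝ ∞ φ → HasCompactSupport φ → tsupport φ ⊆ U →
    ∀ w : Euc d₂, ∫ v in U, (fderiv ℝ φ v w) • b v = - ∫ v in U, φ v • Db v w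

/-- The nondegeneracy condition on `B_R`: for all `μ ∈ ℝ`, all unit vectors `ν` and all `ε > 0`,
`|{v ∈ B_R : |μ + b(v) · ν| ≤ ε}| ≤ K ε ^ α`. -/
def IsNondegenerate {d₁ d₂ : ℕ} (R K α : ℝ) (b : Euc d₂ → Euc d₁) : Prop :=
  ∀ μ : ℝ, ∀ ν ∈ sphere (0 : Euc d₁) 1, ∀ ε > 0,
    volume {v ∈ ball (0 : Euc d₂) R | |μ + inner ℝ (b v) ν| ≤ ε} ≤ ENNReal.ofReal (K * ε ^ α)

/-- `(∂_t + b(v) · ∇_x) h = div_v g₁ + g₀` in the sense of distributions on `ℝ × ℝ^{d₁} × B_R`.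
Since `b` does not depend on `(t, x)`, tested against `φ ∈ C_c^∞` this reads
`- ∫ h (∂_t φ + b · ∇_x φ) = - ∫ g₁ · ∇_v φ + ∫ g₀ φ`.
In the code `fderiv ℝ φ p (1, b p.2.2, 0)` is `∂_t φ + b · ∇_x φ` at the point `p = (t, x, v)`, and
`fderiv ℝ φ p (0, 0, g₁ p)` is `g₁ · ∇_v φ`. -/
def IsTransportSolution {d₁ d₂ : ℕ} (R : ℝ) (b : Euc d₂ → Euc d₁)
    (h : ℝ × Euc d₁ × Euc d₂ → ℝ) (g₁ : ℝ × Euc d₁ × Euc d₂ → Euc d₂)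
    (g₀ : ℝ × Euc d₁ × Euc d₂ → ℝ) : Prop :=
  ∀ φ : ℝ × Euc d₁ × Euc d₂ → ℝ, ContDiff ℝ ∞ φ → HasCompactSupport φ →
    tsupport φ ⊆ phaseDomain d₁ d₂ R →
    - ∫ p in phaseDomain d₁ d₂ R, h p * fderiv ℝ φ p (1, b p.2.2, 0) =
      - (∫ p in phaseDomain d₁ d₂ R, fderiv ℝ φ p (0, 0, g₁ p)) +
        ∫ p in phaseDomain d₁ d₂ R, g₀ p * φ p

/-- The velocity average `h_ψ(t, x) = ∫_{B_R} h(t, x, v) ψ(v) dv`, as a (complex-valued) function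
on space-time. -/
noncomputable def velocityAverage {d₁ d₂ : ℕ} (R : ℝ) (h : ℝ × Euc d₁ × Euc d₂ → ℝ)
    (ψ : Euc d₂ → ℝ) (z : SpaceTime d₁) : ℂ :=
  ((∫ v in ball (0 : Euc d₂) R, h (z.fst, z.snd, v) * ψ v : ℝ) : ℂ)

/-- The norm of `H^s = H^{s,2}`, matching Mathlib's `TemperedDistribution.MemSobolev s 2`: the
`L²` norm of the (unique, if it exists) `L²` function representing the Bessel potential
`𝓕⁻ (1 + ‖ζ‖²)^{s/2} 𝓕 u`; it is `∞` if there is none. -/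
noncomputable def sobolevNorm {E : Type*} [NormedAddCommGroup E] [InnerProductSpace ℝ E]
    [FiniteDimensional ℝ E] [MeasurableSpace E] [BorelSpace E] (s : ℝ) (u : 𝓢'(E, ℂ)) : ℝ≥0∞ :=
  ⨅ (w : Lp ℂ 2 (volume : Measure E))
    (_ : TemperedDistribution.besselPotential E ℂ s u = (w : 𝓢'(E, ℂ))), ‖w‖ₑ

/-- The norm of `W^{1,∞}(B_R)` of a `C¹` function: `‖ψ‖_{L^∞} + ‖∇ψ‖_{L^∞}`. -/
noncomputable def w1InftyNorm {d₂ : ℕ} (R : ℝ) (ψ : Euc d₂ → ℝ) : ℝ≥0∞ :=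
  eLpNorm ψ ∞ (volume.restrict (ball 0 R)) + eLpNorm (fderiv ℝ ψ) ∞ (volume.restrict (ball 0 R))

/-! The Fourier transform in space-time turns the equation into 2πi A(v) ĥ = div_v ĝ₁ + ĝ₀ at each
frequency ζ = (τ, ξ), where A(v) = τ + b(v)·ξ. Where A is large, ĥ is controlled by dividing by A.
Where A is small, nondegeneracy makes the set of velocities small. To interpolate, put N = |ζ|, δ =
εN and split ψ = Aη + ψw with η = ψA/(A² + δ²) and w = δ²/(A² + δ²).

Testing the equation with η and moving the velocity derivative onto it costs the L² norms of η and
∇η. Since the gradient of A is at most |ξ||Db|, both are at most a constant times (ε²N)⁻¹. A dyadic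
sum over the size of A (`lintegral_regularized_le`), fed by `IsNondegenerate.measure_symbol_le`,
bounds ‖w‖² by a constant times ε^α. This is `norm_integral_average_le`. The choice ε = N^(-2/(4+α))
makes both contributions N^(-α/(4+α)), see `sobolev_weight_mul_le`, and Plancherel converts the
pointwise bound into the Sobolev bound. All powers of fixed constants are controlled through 0 < α ≤
1, so the final constant is free of α.

Two points need care. First, h is only square integrable in v, so it is treated as an L²-valued
function of space-time (`exists_Lp_curry`), whose Fourier transform commutes with continuous
functionals. For fixed η the transformed equation holds off a null set depending on η, whereas the η
above depends on ζ. Both sides are continuous in the L² data of η, and L² is separable, so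
`ae_forall_of_forall_ae_isClosed` yields one null set for all η. Second, η is only as regular as b.
`HasH1Deriv.exists_test_sequence` replaces it by smooth functions obeying the same L² bounds, and
the limit is taken only in the pairing with Aη. -/

section

open scoped FourierTransform LineDeriv Topology
open Filter

/-! ### Hilbert-valued square integrable functions and their Fourier transforms -/

/-- A map into a separable metric space is measurable if its distance to every point is. -/
theorem measurable_of_measurable_dist {α X : Type*} [MeasurableSpace α] [MetricSpace X]
    [SecondCountableTopology X] [MeasurableSpace X] [BorelSpace X] {f : α → X}
    (hf : ∀ c, Measurable fun a => dist (f a) c) : Measurable f := by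
  refine measurable_of_isOpen fun s hs => ?_
  choose! r hr0 hr using Metric.isOpen_iff.1 hs
  obtain ⟨T, hTs, hTc, hT⟩ := TopologicalSpace.isOpen_biUnion_countable s (fun x => ball x (r x))
    (fun _ _ => isOpen_ball)
  have hsT : s = ⋃ x ∈ T, ball x (r x) := by
    rw [hT]
    refine Subset.antisymm (fun x hx => mem_iUnion₂.2 ⟨x, hx, mem_ball_self (hr0 x hx)⟩) ?_
    exact iUnion₂_subset hr
  rw [hsT, preimage_iUnion₂]
  exact MeasurableSet.biUnion hTc fun x _ => measurableSet_lt (hf x) measurable_const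

theorem secondCountable_L2 {V : Type*} [MeasurableSpace V] [MeasurableSpace.CountablyGenerated V]
    {μ : Measure V} [SigmaFinite μ] : SecondCountableTopology (Lp ℂ 2 μ) := by
  have : Fact ((2 : ℝ≥0∞) ≠ ⊤) := ⟨by norm_num⟩
  exact Lp.SecondCountableTopology

theorem eLpNorm_two_sq {α E : Type*} [MeasurableSpace α] [NormedAddCommGroup E] (μ : Measure α)
    (f : α → E) : eLpNorm f 2 μ ^ 2 = ∫⁻ a, ‖f a‖ₑ ^ 2 ∂μ := by
  simpa using eLpNorm_nnreal_pow_eq_lintegral (f := f) (μ := μ) (p := 2) (by norm_num)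

/-- A square integrable function on a product, viewed as a square integrable function with values
in `L²` of the second factor. -/
theorem exists_Lp_curry {Z V : Type*} [MeasurableSpace Z] [MeasurableSpace V]
    [MeasurableSpace.CountablyGenerated V] {ν : Measure Z} {μ : Measure V} [SFinite ν]
    [SigmaFinite μ] {f : Z × V → ℂ} (hf : MemLp f 2 (ν.prod μ)) :
    ∃ F : Lp (Lp ℂ 2 μ) 2 ν, (∀ᵐ z ∂ν, F z =ᵐ[μ] fun v => f (z, v)) ∧
      ‖F‖ₑ = eLpNorm f 2 (ν.prod μ) := by
  classical
  have : SecondCountableTopology (Lp ℂ 2 μ) := secondCountable_L2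
  let : MeasurableSpace (Lp ℂ 2 μ) := borel _
  have : BorelSpace (Lp ℂ 2 μ) := ⟨rfl⟩
  -- A strongly measurable representative has measurable slices for every z, not just almost every
  -- z.
  set g := hf.1.mk f with hg
  have hgm : StronglyMeasurable g := hf.1.stronglyMeasurable_mk
  have hgf : f =ᵐ[ν.prod μ] g := hf.1.ae_eq_mk
  have hgz : ∀ z, AEStronglyMeasurable (fun v => g (z, v)) μ := fun z =>
    (hgm.comp_measurable measurable_prodMk_left).aestronglyMeasurable
  have hmeas : ∀ c : V → ℂ, StronglyMeasurable c →
      Measurable fun z => eLpNorm (fun v => g (z, v) - c v) 2 μ := by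
    intro c hc
    have : ∀ z, eLpNorm (fun v => g (z, v) - c v) 2 μ
        = (∫⁻ v, ‖g (z, v) - c v‖ₑ ^ 2 ∂μ) ^ (1 / 2 : ℝ) := fun z => by
      rw [← eLpNorm_two_sq, ← ENNReal.rpow_natCast, ← ENNReal.rpow_mul]; norm_num
    simp_rw [this]
    refine Measurable.pow_const ?_ _
    refine Measurable.lintegral_prod_right' (f := fun p : Z × V => ‖g p - c p.2‖ₑ ^ 2) ?_
    exact ((hgm.sub (hc.comp_measurable measurable_snd)).enorm).pow_const 2
  set S : Set Z := {z | MemLp (fun v => g (z, v)) 2 μ} with hS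
  have hSm : MeasurableSet S := by
    have : S = {z | eLpNorm (fun v => g (z, v) - 0) 2 μ < ⊤} := by
      ext z; simp [hS, MemLp, hgz z]
    rw [this]
    exact measurableSet_lt (hmeas (fun _ => 0) stronglyMeasurable_const) measurable_const
  set F0 : Z → Lp ℂ 2 μ := fun z => if h : MemLp (fun v => g (z, v)) 2 μ then h.toLp _ else 0
  have hF0 : ∀ z ∈ S, F0 z =ᵐ[μ] fun v => g (z, v) := fun z hz => by
    simp only [F0, dif_pos (show MemLp (fun v => g (z, v)) 2 μ from hz)]
    exact MemLp.coeFn_toLp _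
  have hF0m : Measurable F0 := by
    -- `F0` is chosen slice by slice, with no evident measurability. Its distance to a fixed class
    -- is the root of a parametrised integral, which is measurable by Tonelli.
    refine measurable_of_measurable_dist fun c => ?_
    have : (fun z => dist (F0 z) c) = fun z => if z ∈ S then
        (eLpNorm (fun v => g (z, v) - c v) 2 μ).toReal else ‖c‖ := by
      funext z
      split_ifs with hz
      · rw [Lp.dist_def]
        congr 1
        exact eLpNorm_congr_ae ((hF0 z hz).sub (ae_eq_refl _))
      · have : F0 z = 0 := by simp only [F0]; exact dif_neg hz
        rw [this, dist_zero_left]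
    rw [this]
    exact Measurable.ite hSm (hmeas c (Lp.stronglyMeasurable c)).ennreal_toReal measurable_const
  have hfin : ∫⁻ z, ∫⁻ v, ‖g (z, v)‖ₑ ^ 2 ∂μ ∂ν = eLpNorm f 2 (ν.prod μ) ^ 2 := by
    rw [eLpNorm_congr_ae hgf, eLpNorm_two_sq,
      lintegral_prod _ (hgm.enorm.pow_const 2).aemeasurable]
  have hSae : ∀ᵐ z ∂ν, z ∈ S := by
    have h1 : ∀ᵐ z ∂ν, ∫⁻ v, ‖g (z, v)‖ₑ ^ 2 ∂μ < ⊤ := by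
      refine ae_lt_top (Measurable.lintegral_prod_right' (f := fun p : Z × V => ‖g p‖ₑ ^ 2)
        (hgm.enorm.pow_const 2)) ?_
      rw [hfin]
      exact ENNReal.pow_ne_top hf.2.ne
    filter_upwards [h1] with z hz
    refine ⟨hgz z, ?_⟩
    rw [← eLpNorm_two_sq] at hz
    exact (ENNReal.pow_lt_top_iff.1 hz).resolve_right (by norm_num)
  have hnorm : eLpNorm F0 2 ν = eLpNorm f 2 (ν.prod μ) := by
    have : eLpNorm F0 2 ν ^ 2 = eLpNorm f 2 (ν.prod μ) ^ 2 := by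
      rw [eLpNorm_two_sq, ← hfin]
      refine lintegral_congr_ae ?_
      filter_upwards [hSae] with z hz
      rw [Lp.enorm_def, eLpNorm_congr_ae (hF0 z hz), eLpNorm_two_sq]
    exact (ENNReal.pow_right_strictMono (n := 2) (by norm_num)).injective this
  have hF0L : MemLp F0 2 ν :=
    ⟨hF0m.stronglyMeasurable.aestronglyMeasurable, by rw [hnorm]; exact hf.2⟩
  refine ⟨hF0L.toLp F0, ?_, ?_⟩
  · have h2 := Measure.ae_ae_of_ae_prod hgf
    filter_upwards [hF0L.coeFn_toLp, hSae, h2] with z h3 hz h4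
    rw [h3]
    filter_upwards [hF0 z hz, h4] with v h5 h6
    rw [h5, h6]
  · rw [Lp.enorm_toLp, hnorm]

section Fourier

variable {E : Type*} [NormedAddCommGroup E] [InnerProductSpace ℝ E] [FiniteDimensional ℝ E]
  [MeasurableSpace E] [BorelSpace E]

theorem Lp_eq_of_toTemperedDistribution_eq {F : Type*} [NormedAddCommGroup F] [NormedSpace ℂ F]
    [CompleteSpace F] {f g : Lp F 2 (volume : Measure E)}
    (h : (f : 𝓢'(E, F)) = (g : 𝓢'(E, F))) : f = g := by
  have := Lp.ker_toTemperedDistributionCLM_eq_bot (F := F) (μ := (volume : Measure E)) (p := 2)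
  exact LinearMap.ker_eq_bot.1 this h

theorem integrable_schwartz_smul {F : Type*} [NormedAddCommGroup F] [NormedSpace ℂ F]
    (κ : 𝓢(E, ℂ)) (f : Lp F 2 (volume : Measure E)) : Integrable (fun x => κ x • f x) :=
  memLp_one_iff_integrable.1 ((Lp.memLp f).smul (κ.memLp 2 volume))

/-- The Fourier transform on `L²` commutes with continuous linear functionals. -/
theorem fourier_compLp {F : Type*} [NormedAddCommGroup F] [InnerProductSpace ℂ F]
    [CompleteSpace F] (L : F →L[ℂ] ℂ) (f : Lp F 2 (volume : Measure E)) :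
    (𝓕 (L.compLp f) : Lp ℂ 2 (volume : Measure E)) = L.compLp (𝓕 f) := by
  have key : ∀ (κ : 𝓢(E, ℂ)) (g : Lp F 2 (volume : Measure E)),
      (L.compLp g : 𝓢'(E, ℂ)) κ = L ((g : 𝓢'(E, F)) κ) := by
    intro κ g
    rw [Lp.toTemperedDistribution_apply, Lp.toTemperedDistribution_apply,
      ← L.integral_comp_comm (integrable_schwartz_smul κ g)]
    refine integral_congr_ae ?_
    filter_upwards [L.coeFn_compLp g] with x hx
    rw [hx, map_smul]
  refine Lp_eq_of_toTemperedDistribution_eq ?_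
  ext κ
  rw [key, ← Lp.fourier_toTemperedDistribution_eq, ← Lp.fourier_toTemperedDistribution_eq,
    TemperedDistribution.fourier_apply, TemperedDistribution.fourier_apply, key]

end Fourier

/-- If closed conditions depending on a parameter hold almost everywhere for each member of a
family in a separable metric space, then almost everywhere they hold for all members at once. -/
theorem ae_forall_of_forall_ae_isClosed {α ι X : Type*} [MeasurableSpace α] {μ : Measure α}
    [PseudoMetricSpace X] [SecondCountableTopology X] (T : ι → X) (P : α → X → Prop)
    (hP : ∀ a, IsClosed {x | P a x}) (h : ∀ i, ∀ᵐ a ∂μ, P a (T i)) :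
    ∀ᵐ a ∂μ, ∀ i, P a (T i) := by
  -- The countable dense set is taken inside the range of `T`, because the condition is known only
  -- for members of the family.
  obtain ⟨D, hDs, hDc, hD⟩ :=
    (TopologicalSpace.IsSeparable.of_separableSpace (range T)).exists_countable_dense_subset
  have : ∀ᵐ a ∂μ, ∀ x ∈ D, P a x := by
    rw [ae_ball_iff hDc]
    intro x hx
    obtain ⟨i, rfl⟩ := hDs hx
    exact h i
  filter_upwards [this] with a ha i
  exact (closure_minimal ha (hP a)) (hD (mem_range_self i))

end

/-! ### From weak equations to pointwise identities on the Fourier side -/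

section

open scoped FourierTransform LineDeriv Topology
open Filter

/-- Dilates of one bump function. The gradient decay of order 1/n makes the error term vanish when a
Schwartz function is truncated to compact support. -/
theorem exists_cutoff_sequence {E : Type*} [NormedAddCommGroup E] [InnerProductSpace ℝ E]
    [FiniteDimensional ℝ E] : ∃ (t : ℕ → E → ℂ) (D : ℝ), 0 ≤ D ∧
    (∀ n, ContDiff ℝ ∞ (t n)) ∧ (∀ n, HasCompactSupport (t n)) ∧ (∀ n x, ‖t n x‖ ≤ 1) ∧
    (∀ x, Tendsto (fun n => t n x) atTop (𝓝 1)) ∧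
    ∀ n x w, ‖fderiv ℝ (t n) x w‖ ≤ ((n : ℝ) + 1)⁻¹ * (D * ‖w‖) := by
  let θ : ContDiffBump (0 : E) := ⟨1, 2, one_pos, one_lt_two⟩
  set a : ℕ → ℝ := fun n => ((n : ℝ) + 1)⁻¹ with ha
  have ha0 : Tendsto a atTop (𝓝 0) := tendsto_inv_atTop_zero.comp
    (tendsto_atTop_add_const_right _ _ tendsto_natCast_atTop_atTop)
  have hapos : ∀ n, 0 < a n := fun n => by simp only [ha]; positivity
  obtain ⟨D, hD⟩ : ∃ D, ∀ x, ‖fderiv ℝ (θ : E → ℝ) x‖ ≤ D :=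
    (θ.hasCompactSupport.fderiv (𝕜 := ℝ)).exists_bound_of_continuous
      ((θ.contDiff (n := 1)).continuous_fderiv (by simp))
  refine ⟨fun n x => (θ (a n • x) : ℂ), D, (norm_nonneg _).trans (hD 0), fun n =>
    Complex.ofRealCLM.contDiff.comp (θ.contDiff.comp (contDiff_const_smul (a n))), fun n =>
    (θ.hasCompactSupport.comp_smul (hapos n).ne').comp_left (g := fun s : ℝ => (s : ℂ)) rfl,
    fun n x => ?_, fun x => ?_, fun n x w => ?_⟩
  · simp only [Complex.norm_real, Real.norm_eq_abs, abs_of_nonneg θ.nonneg]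
    exact θ.le_one
  · have h0 : Tendsto (fun n => a n • x) atTop (𝓝 0) := by
      simpa using ha0.smul_const x
    have h1 : Tendsto (fun n => θ (a n • x)) atTop (𝓝 (θ 0)) :=
      (θ.continuous.tendsto 0).comp h0
    rw [θ.one_of_mem_closedBall (mem_closedBall_self zero_le_one)] at h1
    exact (Complex.continuous_ofReal.tendsto 1).comp h1
  · have h1 : HasFDerivAt (fun x : E => a n • x) (a n • ContinuousLinearMap.id ℝ E) x :=
      (hasFDerivAt_id x).const_smul (a n)
    have h2 : HasFDerivAt (θ : E → ℝ) (fderiv ℝ θ (a n • x)) (a n • x) :=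
      ((θ.contDiff (n := 1)).differentiable (by simp) _).hasFDerivAt
    have h3 := Complex.ofRealCLM.hasFDerivAt.comp x (h2.comp x h1)
    have h4 : fderiv ℝ (fun x => (θ (a n • x) : ℂ)) x w
        = ((a n * fderiv ℝ θ (a n • x) w : ℝ) : ℂ) := by
      rw [show (fun x => (θ (a n • x) : ℂ)) = Complex.ofRealCLM ∘ ((θ : E → ℝ) ∘ fun x => a n • x)
        from rfl, h3.fderiv]
      simp
    rw [h4, Complex.norm_real, norm_mul, Real.norm_eq_abs, abs_of_pos (hapos n)]
    gcongr
    exact (ContinuousLinearMap.le_opNorm _ _).trans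
      (mul_le_mul_of_nonneg_right (hD _) (norm_nonneg _))

section WeakEquation

variable {E : Type*} [NormedAddCommGroup E] [InnerProductSpace ℝ E] [FiniteDimensional ℝ E]
  [MeasurableSpace E] [BorelSpace E]

theorem integrable_mul_L2 {χ : E → ℂ} (hχ : Continuous χ) (hc : HasCompactSupport χ)
    (f : Lp ℂ 2 (volume : Measure E)) : Integrable (fun x => χ x * f x) :=
  (hχ.memLp_of_hasCompactSupport (p := 2) hc).integrable_mul (Lp.memLp f)

/-- A weak equation tested against real test functions can be tested against complex ones. -/
theorem weak_eq_complex {ι : Type*} [Fintype ι] (m : ι → E)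
    (U : ι → Lp ℂ 2 (volume : Measure E)) (r : Lp ℂ 2 (volume : Measure E))
    (h : ∀ χ : E → ℝ, ContDiff ℝ ∞ χ → HasCompactSupport χ →
      ∑ i, ∫ x, ((fderiv ℝ χ x (m i) : ℝ) : ℂ) * U i x = -∫ x, (χ x : ℂ) * r x)
    (χ : E → ℂ) (hχ : ContDiff ℝ ∞ χ) (hc : HasCompactSupport χ) :
    ∑ i, ∫ x, fderiv ℝ χ x (m i) * U i x = -∫ x, χ x * r x := by
  have hre : ContDiff ℝ ∞ fun x => (χ x).re := Complex.reCLM.contDiff.comp hχ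
  have him : ContDiff ℝ ∞ fun x => (χ x).im := Complex.imCLM.contDiff.comp hχ
  have hcre : HasCompactSupport fun x => (χ x).re := hc.comp_left (g := Complex.re) rfl
  have hcim : HasCompactSupport fun x => (χ x).im := hc.comp_left (g := Complex.im) rfl
  have hd : Differentiable ℝ χ := hχ.differentiable (by simp)
  have dre : ∀ x w, fderiv ℝ (fun x => (χ x).re) x w = (fderiv ℝ χ x w).re := fun x w => by
    have := (Complex.reCLM.hasFDerivAt.comp x (hd x).hasFDerivAt).fderiv
    rw [show (fun x => (χ x).re) = Complex.reCLM ∘ χ from rfl, this]; rfl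
  have dim : ∀ x w, fderiv ℝ (fun x => (χ x).im) x w = (fderiv ℝ χ x w).im := fun x w => by
    have := (Complex.imCLM.hasFDerivAt.comp x (hd x).hasFDerivAt).fderiv
    rw [show (fun x => (χ x).im) = Complex.imCLM ∘ χ from rfl, this]; rfl
  have split : ∀ (a : E → ℂ) (f : Lp ℂ 2 (volume : Measure E)), Continuous a →
      HasCompactSupport a → ∫ x, a x * f x =
        (∫ x, ((a x).re : ℂ) * f x) + Complex.I * ∫ x, ((a x).im : ℂ) * f x := by
    intro a f ha hac
    rw [← integral_const_mul, ← integral_add]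
    · refine integral_congr_ae (Eventually.of_forall fun x => ?_)
      change a x * f x = ((a x).re : ℂ) * f x + Complex.I * (((a x).im : ℂ) * f x)
      conv_lhs => rw [← Complex.re_add_im (a x)]
      ring
    · refine integrable_mul_L2 (by fun_prop) ?_ f
      exact hac.comp_left (g := fun z : ℂ => ((z.re : ℝ) : ℂ)) (by simp)
    · refine (integrable_mul_L2 (by fun_prop) ?_ f).const_mul _
      exact hac.comp_left (g := fun z : ℂ => ((z.im : ℝ) : ℂ)) (by simp)
  have h1 := h _ hre hcre
  have h2 := h _ him hcim
  simp only [dre, dim] at h1 h2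
  have hcont : ∀ i, Continuous fun x => fderiv ℝ χ x (m i) := fun i =>
    (hχ.continuous_fderiv (by simp)).clm_apply continuous_const
  have hcs : ∀ i, HasCompactSupport fun x => fderiv ℝ χ x (m i) := fun i =>
    (hc.fderiv (𝕜 := ℝ)).comp_left (g := fun L : E →L[ℝ] ℂ => L (m i)) rfl
  rw [split χ r hχ.continuous hc, neg_add, ← h1, ← mul_neg, ← h2, Finset.mul_sum,
    ← Finset.sum_add_distrib]
  exact Finset.sum_congr rfl fun i _ => split _ _ (hcont i) (hcs i)

/-- A weak equation between square integrable functions can be tested against Schwartz functions. -/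
theorem weak_eq_schwartz {ι : Type*} [Fintype ι] (m : ι → E)
    (U : ι → Lp ℂ 2 (volume : Measure E)) (r : Lp ℂ 2 (volume : Measure E))
    (h : ∀ χ : E → ℝ, ContDiff ℝ ∞ χ → HasCompactSupport χ →
      ∑ i, ∫ x, ((fderiv ℝ χ x (m i) : ℝ) : ℂ) * U i x = -∫ x, (χ x : ℂ) * r x)
    (κ : 𝓢(E, ℂ)) :
    ∑ i, ∫ x, (∂_{m i} κ) x * U i x = -∫ x, κ x * r x := by
  obtain ⟨t, D, hD, htsm, htc, htle, htlim, htd⟩ := exists_cutoff_sequence (E := E)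
  have ha0 : Tendsto (fun n : ℕ => ((n : ℝ) + 1)⁻¹) atTop (𝓝 0) := tendsto_inv_atTop_zero.comp
    (tendsto_atTop_add_const_right _ _ tendsto_natCast_atTop_atTop)
  have hprod : ∀ n x w, fderiv ℝ (fun x => t n x * κ x) x w
      = t n x * (∂_{w} κ) x + fderiv ℝ (t n) x w * κ x := by
    intro n x w
    have h1 := (((htsm n).differentiable (by simp)) x).hasFDerivAt
    have h2 := (κ.differentiable x).hasFDerivAt
    rw [show (fun x => t n x * κ x) = t n * κ from rfl, (h1.mul h2).fderiv]
    simp [SchwartzMap.lineDerivOp_apply_eq_fderiv, mul_comm]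
  have hcd : ∀ n, ContDiff ℝ ∞ fun x => t n x * κ x := fun n => (htsm n).mul κ.smooth'
  have key : ∀ n, ∑ i, ∫ x, fderiv ℝ (fun x => t n x * κ x) x (m i) * U i x
      = -∫ x, t n x * κ x * r x := fun n =>
    weak_eq_complex m U r h _ (hcd n) ((htc n).mul_right)
  have lim1 : Tendsto (fun n => -∫ x, t n x * κ x * r x) atTop (𝓝 (-∫ x, κ x * r x)) := by
    refine Tendsto.neg ?_
    refine tendsto_integral_of_dominated_convergence (fun x => ‖κ x * r x‖) ?_
      (integrable_schwartz_smul κ r).norm ?_ ?_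
    · exact fun n => ((hcd n).continuous.aestronglyMeasurable).mul (Lp.aestronglyMeasurable r)
    · intro n
      refine Eventually.of_forall fun x => ?_
      rw [mul_assoc, norm_mul]
      exact mul_le_of_le_one_left (norm_nonneg _) (htle n x)
    · refine Eventually.of_forall fun x => ?_
      have h3 := (htlim x).mul_const (κ x * r x)
      rw [one_mul] at h3
      exact h3.congr fun n => by rw [mul_assoc]
  have lim2 : Tendsto (fun n => ∑ i, ∫ x, fderiv ℝ (fun x => t n x * κ x) x (m i) * U i x)
      atTop (𝓝 (∑ i, ∫ x, (∂_{m i} κ) x * U i x)) := by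
    refine tendsto_finsetSum _ fun i _ => ?_
    have hI1 : Integrable fun x => (∂_{m i} κ) x * U i x := integrable_schwartz_smul _ _
    have hI2 : Integrable fun x => κ x * U i x := integrable_schwartz_smul _ _
    -- The second summand dominates the part carrying the gradient of the cutoff, using (n + 1)⁻¹ ≤
    -- 1; that part tends to zero pointwise.
    have hI : Integrable fun x => ‖(∂_{m i} κ) x * U i x‖ + D * ‖m i‖ * ‖κ x * U i x‖ :=
      hI1.norm.add (hI2.norm.const_mul _)
    refine tendsto_integral_of_dominated_convergence _ ?_ hI ?_ ?_
    · exact fun n => ((((hcd n).continuous_fderiv (by simp)).clm_apply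
        continuous_const).aestronglyMeasurable).mul (Lp.aestronglyMeasurable _)
    · intro n
      refine Eventually.of_forall fun x => ?_
      rw [hprod, add_mul]
      refine (norm_add_le _ _).trans (add_le_add ?_ ?_)
      · rw [mul_assoc, norm_mul]
        exact mul_le_of_le_one_left (norm_nonneg _) (htle n x)
      · rw [mul_assoc, norm_mul]
        refine mul_le_mul_of_nonneg_right ((htd n x _).trans ?_) (norm_nonneg _)
        exact mul_le_of_le_one_left (by positivity) (inv_le_one_of_one_le₀ (by simp))
    · refine Eventually.of_forall fun x => ?_
      simp_rw [hprod, add_mul]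
      have h2 : Tendsto (fun n => fderiv ℝ (t n) x (m i)) atTop (𝓝 0) := by
        refine squeeze_zero_norm (fun n => htd n x _) ?_
        simpa using ha0.mul_const (D * ‖m i‖)
      have h3 := ((htlim x).mul_const ((∂_{m i} κ) x * U i x)).add (h2.mul_const (κ x * U i x))
      rw [one_mul, zero_mul, add_zero] at h3
      exact h3.congr fun n => by rw [mul_assoc, mul_assoc]
  simp_rw [key] at lim2
  exact tendsto_nhds_unique lim2 lim1

/-- A first order constant coefficient equation in `L²` on the Fourier side. -/
theorem fourier_of_weak_eq {ι : Type*} [Fintype ι] (m : ι → E)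
    (U : ι → Lp ℂ 2 (volume : Measure E)) (r : Lp ℂ 2 (volume : Measure E))
    (h : ∀ χ : E → ℝ, ContDiff ℝ ∞ χ → HasCompactSupport χ →
      ∑ i, ∫ x, ((fderiv ℝ χ x (m i) : ℝ) : ℂ) * U i x = -∫ x, (χ x : ℂ) * r x) :
    ∀ᵐ ζ : E, ∑ i, 2 * Real.pi * Complex.I * (inner ℝ ζ (m i) : ℝ) *
      (𝓕 (U i) : Lp ℂ 2 (volume : Measure E)) ζ = (𝓕 r : Lp ℂ 2 (volume : Measure E)) ζ := by
  have hT : ∑ i, ∂_{m i} (U i : 𝓢'(E, ℂ)) = (r : 𝓢'(E, ℂ)) := by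
    ext κ
    have := weak_eq_schwartz m U r h κ
    simp only [sum_apply, TemperedDistribution.lineDerivOp_apply_apply,
      map_neg, Lp.toTemperedDistribution_apply, smul_eq_mul, Finset.sum_neg_distrib]
    rw [this, neg_neg]
  have hF := congrArg (fun T : 𝓢'(E, ℂ) => 𝓕 T) hT
  have hsum : 𝓕 (∑ i, ∂_{m i} (U i : 𝓢'(E, ℂ))) = ∑ i, 𝓕 (∂_{m i} (U i : 𝓢'(E, ℂ))) :=
    map_sum (FourierTransform.fourierCLM ℂ 𝓢'(E, ℂ)) _ _
  simp only [hsum, TemperedDistribution.fourier_lineDerivOp_eq,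
    Lp.fourier_toTemperedDistribution_eq] at hF
  have hloc : ∀ f : Lp ℂ 2 (volume : Measure E), LocallyIntegrable f := fun f =>
    (Lp.memLp f).locallyIntegrable (by norm_num)
  have hli : ∀ i, LocallyIntegrable fun ζ : E => 2 * Real.pi * Complex.I *
      (inner ℝ ζ (m i) : ℝ) * (𝓕 (U i) : Lp ℂ 2 (volume : Measure E)) ζ := by
    intro i
    have hc : Continuous fun ζ : E => 2 * Real.pi * Complex.I * ((inner ℝ ζ (m i) : ℝ) : ℂ) := by
      fun_prop
    exact LocallyIntegrable.continuous_smul hc (hloc _)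
  -- The multipliers are unbounded, so the individual terms are only known to be locally integrable.
  -- The distributional identity is therefore localised by compactly supported smooth functions.
  have := ae_eq_zero_of_integral_contDiff_smul_eq_zero (μ := (volume : Measure E))
    (f := fun ζ => ∑ i, 2 * Real.pi * Complex.I * (inner ℝ ζ (m i) : ℝ) *
      (𝓕 (U i) : Lp ℂ 2 (volume : Measure E)) ζ - (𝓕 r : Lp ℂ 2 (volume : Measure E)) ζ) ?_ ?_
  · filter_upwards [this] with ζ hζ
    exact sub_eq_zero.1 hζ
  · exact (locallyIntegrable_finsetSum _ fun i _ => hli i).sub (hloc _)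
  · intro g hg hgc
    have hg' : ContDiff ℝ ∞ fun x => (g x : ℂ) := Complex.ofRealCLM.contDiff.comp hg
    have hgc' : HasCompactSupport fun x => (g x : ℂ) :=
      hgc.comp_left (g := fun s : ℝ => (s : ℂ)) rfl
    have h1 := congrArg (fun T : 𝓢'(E, ℂ) => T (hgc'.toSchwartzMap hg')) hF
    have htg : ∀ i, (fun ζ : E => ((inner ℝ ζ (m i) : ℝ) : ℂ)).HasTemperateGrowth :=
      fun i => by fun_prop
    simp only [sum_apply, smul_apply, TemperedDistribution.smulLeftCLM_apply_apply,
      Lp.toTemperedDistribution_apply, SchwartzMap.smulLeftCLM_apply_apply (htg _),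
      HasCompactSupport.toSchwartzMap_toFun, smul_eq_mul] at h1
    have hint : ∀ i, Integrable fun x => (g x : ℂ) * (2 * Real.pi * Complex.I *
        (inner ℝ x (m i) : ℝ) * (𝓕 (U i) : Lp ℂ 2 (volume : Measure E)) x) := by
      intro i
      have := integrable_mul_L2 (χ := fun x => (g x : ℂ) * (2 * Real.pi * Complex.I *
        (inner ℝ x (m i) : ℝ))) (hg'.continuous.mul (by fun_prop)) hgc'.mul_right (𝓕 (U i))
      simpa only [mul_assoc] using this
    simp only [Complex.real_smul, mul_sub, Finset.mul_sum]
    rw [integral_sub (integrable_finsetSum _ fun i _ => hint i)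
      (integrable_mul_L2 hg'.continuous hgc' _), integral_finsetSum _ fun i _ => hint i, ← h1,
      sub_eq_zero]
    refine Finset.sum_congr rfl fun i _ => ?_
    rw [← integral_const_mul]
    refine integral_congr_ae (Eventually.of_forall fun x => ?_)
    simp only
    ring
end WeakEquation

end

/-! ### Mollification of the cutoff and of the vector field -/

section

open scoped Topology Convolution
open Filter ContinuousLinearMap

section Mollification

variable {V : Type*} [NormedAddCommGroup V] [InnerProductSpace ℝ V] [FiniteDimensional ℝ V]
  [MeasurableSpace V] [BorelSpace V]
  {F : Type*} [NormedAddCommGroup F] [NormedSpace ℝ F]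

/-- Jensen's inequality for the probability density ρ: Cauchy–Schwarz after writing ρf as the
product of √ρ and √ρ f. -/
theorem lintegral_mul_sq_le {α : Type*} [MeasurableSpace α] {μ : Measure α} {ρ f : α → ℝ≥0∞}
    (hρ : AEMeasurable ρ μ) (hf : AEMeasurable f μ) (h1 : ∫⁻ a, ρ a ∂μ = 1) :
    (∫⁻ a, ρ a * f a ∂μ) ^ 2 ≤ ∫⁻ a, ρ a * f a ^ 2 ∂μ := by
  have hsq : ∀ x : ℝ≥0∞, x ^ (1 / 2 : ℝ) * x ^ (1 / 2 : ℝ) = x := fun x => by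
    rw [← ENNReal.rpow_add_of_nonneg _ _ (by norm_num) (by norm_num)]; norm_num
  have hsq2 : ∀ x : ℝ≥0∞, (x ^ (1 / 2 : ℝ)) ^ (2 : ℝ) = x := fun x => by
    rw [← ENNReal.rpow_mul]; norm_num
  have h := ENNReal.lintegral_mul_le_Lp_mul_Lq μ (p := 2) (q := 2)
    ⟨by norm_num, by norm_num, by norm_num⟩ (hρ.pow_const (1 / 2 : ℝ))
    ((hρ.pow_const (1 / 2 : ℝ)).mul hf)
  have e1 : ∀ a, ((fun x => ρ x ^ (1 / 2 : ℝ)) * ((fun x => ρ x ^ (1 / 2 : ℝ)) * f)) a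
      = ρ a * f a := fun a => by
    simp only [Pi.mul_apply]; rw [← mul_assoc, hsq]
  have e2 : ∀ a, ((fun x => ρ x ^ (1 / 2 : ℝ)) * f) a ^ (2 : ℝ) = ρ a * f a ^ 2 := fun a => by
    simp only [Pi.mul_apply]
    rw [ENNReal.mul_rpow_of_nonneg _ _ (by norm_num), hsq2]; norm_num
  simp only [e1, e2, hsq2, h1, ENNReal.one_rpow, one_mul] at h
  calc (∫⁻ a, ρ a * f a ∂μ) ^ 2 ≤ ((∫⁻ a, ρ a * f a ^ 2 ∂μ) ^ (1 / 2 : ℝ)) ^ 2 := by gcongr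
    _ = _ := by rw [sq, hsq]

/-- Convolution with a probability density is a contraction of `L²`. -/
theorem eLpNorm_two_convolution_le {ρ : V → ℝ} (hρ : Continuous ρ)
    (h1 : ∫⁻ x, ‖ρ x‖ₑ = 1) {f : V → F} (hf : AEStronglyMeasurable f volume) :
    eLpNorm (ρ ⋆[lsmul ℝ ℝ, volume] f) 2 volume ≤ eLpNorm f 2 volume := by
  have hfm : AEMeasurable (fun p : V × V => ‖f (p.1 - p.2)‖ₑ) (volume.prod volume) :=
    (hf.comp_quasiMeasurePreserving
      (quasiMeasurePreserving_sub_of_right_invariant volume volume)).enorm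
  have hfx : ∀ x, AEMeasurable (fun t => ‖f (x - t)‖ₑ) volume := fun x =>
    (hf.comp_quasiMeasurePreserving (quasiMeasurePreserving_sub_left volume x)).enorm
  have hle : ∀ x, ‖(ρ ⋆[lsmul ℝ ℝ, volume] f) x‖ₑ ^ 2 ≤ ∫⁻ t, ‖ρ t‖ₑ * ‖f (x - t)‖ₑ ^ 2 := by
    intro x
    refine le_trans ?_ (lintegral_mul_sq_le hρ.enorm.aemeasurable (hfx x) h1)
    gcongr
    rw [convolution_def]
    refine (enorm_integral_le_lintegral_enorm _).trans (lintegral_mono fun t => ?_)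
    simp [enorm_smul]
  have hsq : eLpNorm (ρ ⋆[lsmul ℝ ℝ, volume] f) 2 volume ^ 2 ≤ eLpNorm f 2 volume ^ 2 := by
    rw [eLpNorm_two_sq, eLpNorm_two_sq]
    calc ∫⁻ x, ‖(ρ ⋆[lsmul ℝ ℝ, volume] f) x‖ₑ ^ 2
        ≤ ∫⁻ x, ∫⁻ t, ‖ρ t‖ₑ * ‖f (x - t)‖ₑ ^ 2 := lintegral_mono hle
      _ = ∫⁻ t, ∫⁻ x, ‖ρ t‖ₑ * ‖f (x - t)‖ₑ ^ 2 := by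
          refine lintegral_lintegral_swap ?_
          exact ((hρ.comp continuous_snd).enorm.aemeasurable).mul (hfm.pow_const 2)
      _ = ∫⁻ t, ‖ρ t‖ₑ * ∫⁻ x, ‖f x‖ₑ ^ 2 := by
          refine lintegral_congr fun t => ?_
          rw [lintegral_const_mul' _ _ enorm_ne_top,
            lintegral_sub_right_eq_self (fun x => ‖f x‖ₑ ^ 2) t]
      _ = _ := by
          rw [lintegral_mul_const _ hρ.enorm.measurable, h1, one_mul]
  exact (ENNReal.pow_le_pow_left_iff (by norm_num)).1 hsq

theorem lintegral_enorm_normed (φ : ContDiffBump (0 : V)) :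
    ∫⁻ x, ‖φ.normed volume x‖ₑ = 1 := by
  have : ∀ x, ‖φ.normed volume x‖ₑ = ENNReal.ofReal (φ.normed volume x) := fun x =>
    Real.enorm_of_nonneg (φ.nonneg_normed x)
  simp_rw [this]
  rw [← ofReal_integral_eq_lintegral_ofReal φ.integrable_normed
    (Eventually.of_forall φ.nonneg_normed), φ.integral_normed, ENNReal.ofReal_one]

theorem eLpNorm_two_normed_convolution_indicator_le (φ : ContDiffBump (0 : V)) {U : Set V}
    (hU : MeasurableSet U) {f : V → F} (hf : AEStronglyMeasurable (U.indicator f) volume) :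
    eLpNorm (φ.normed volume ⋆[lsmul ℝ ℝ, volume] (U.indicator f)) 2 volume
      ≤ eLpNorm f 2 (volume.restrict U) := by
  refine (eLpNorm_two_convolution_le φ.continuous_normed (lintegral_enorm_normed _) hf).trans ?_
  rw [eLpNorm_indicator_eq_eLpNorm_restrict hU]

theorem norm_normed_convolution_le (φ : ContDiffBump (0 : V)) {f : V → ℝ} {P : ℝ}
    (hP : ∀ x, |f x| ≤ P) (x : V) : |(φ.normed volume ⋆[lsmul ℝ ℝ, volume] f) x| ≤ P := by
  rw [convolution_def, ← Real.norm_eq_abs]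
  refine (norm_integral_le_of_norm_le (φ.integrable_normed.mul_const P)
    (Eventually.of_forall fun t => ?_)).trans ?_
  · simp only [lsmul_apply, smul_eq_mul, norm_mul, Real.norm_eq_abs,
      abs_of_nonneg (φ.nonneg_normed t)]
    exact mul_le_mul_of_nonneg_left (hP _) (φ.nonneg_normed t)
  · rw [integral_mul_const, φ.integral_normed, one_mul]

/-- An average of translates of a P-Lipschitz function is P-Lipschitz, which bounds the derivative
without differentiating under the integral. -/
theorem norm_fderiv_normed_convolution_le (φ : ContDiffBump (0 : V)) {f : V → ℝ} {P : ℝ}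
    (hf : ContDiff ℝ 1 f) (hP : ∀ x, ‖fderiv ℝ f x‖ ≤ P) (x : V) :
    ‖fderiv ℝ (φ.normed volume ⋆[lsmul ℝ ℝ, volume] f) x‖ ≤ P := by
  have hP0 : 0 ≤ P := (norm_nonneg _).trans (hP 0)
  have hLf : LipschitzWith ⟨P, hP0⟩ f :=
    lipschitzWith_of_nnnorm_fderiv_le (hf.differentiable (by simp)) fun y => hP y
  have hL : LipschitzWith ⟨P, hP0⟩ (φ.normed volume ⋆[lsmul ℝ ℝ, volume] f) := by
    refine LipschitzWith.of_dist_le_mul fun y z => ?_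
    have hex := (φ.hasCompactSupport_normed (μ := volume)).convolutionExists_left
      (μ := (volume : Measure V)) (lsmul ℝ ℝ) φ.continuous_normed (g := f)
      hf.continuous.locallyIntegrable
    rw [dist_eq_norm, convolution_def, convolution_def, ← integral_sub (hex y) (hex z)]
    refine (norm_integral_le_of_norm_le (φ.integrable_normed.mul_const (P * dist y z))
      (Eventually.of_forall fun t => ?_)).trans ?_
    · rw [lsmul_apply, lsmul_apply, ← smul_sub, norm_smul, Real.norm_of_nonneg (φ.nonneg_normed t)]
      refine mul_le_mul_of_nonneg_left ?_ (φ.nonneg_normed t)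
      have := hLf.dist_le_mul (y - t) (z - t)
      rwa [dist_sub_right, dist_eq_norm] at this
    · rw [integral_mul_const, φ.integral_normed, one_mul]; rfl
  exact norm_fderiv_le_of_lipschitz ℝ hL

end Mollification

theorem MemLp.integrable_indicator {V F : Type*} [MeasureSpace V]
    [NormedAddCommGroup F] {U : Set V} (hU : MeasurableSet U) (hfin : volume U ≠ ⊤)
    {f : V → F} (hf : MemLp f 2 (volume.restrict U)) : Integrable (U.indicator f) := by
  have : IsFiniteMeasure (volume.restrict U) :=
    ⟨by rw [Measure.restrict_apply_univ]; exact hfin.lt_top⟩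
  exact (integrable_indicator_iff hU).2 (hf.integrable (by norm_num))

/-- Mollification commutes with the weak derivative away from the boundary. -/
theorem HasH1Deriv.fderiv_convolution {d₁ d₂ : ℕ} {U : Set (Euc d₂)} (hU : MeasurableSet U)
    (hfin : volume U ≠ ⊤)
    {b : Euc d₂ → Euc d₁} {Db : Euc d₂ → Euc d₂ →L[ℝ] Euc d₁} (hb : HasH1Deriv U b Db)
    (φ : ContDiffBump (0 : Euc d₂)) {v : Euc d₂} (hv : closedBall v φ.rOut ⊆ U) :
    fderiv ℝ (φ.normed volume ⋆[lsmul ℝ ℝ, volume] (U.indicator b)) v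
      = (φ.normed volume ⋆[lsmul ℝ ℝ, volume] (U.indicator Db)) v := by
  have hbi : Integrable (U.indicator b) :=
    MemLp.integrable_indicator hU hfin hb.memLp
  have hDi : Integrable (U.indicator Db) :=
    MemLp.integrable_indicator hU hfin hb.memLp_deriv
  rw [(φ.hasCompactSupport_normed.hasFDerivAt_convolution_left (lsmul ℝ ℝ) φ.contDiff_normed
    hbi.locallyIntegrable v).fderiv]
  ext1 w
  have hρ : ContDiff ℝ ∞ (φ.normed (volume : Measure (Euc d₂))) := φ.contDiff_normed
  set ρ := φ.normed (volume : Measure (Euc d₂)) with hρdef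
  have hρc : HasCompactSupport ρ := φ.hasCompactSupport_normed
  have hex1 := (hρc.fderiv (𝕜 := ℝ)).convolutionExists_left (μ := (volume : Measure (Euc d₂)))
      (precompL (Euc d₂) (lsmul ℝ ℝ : ℝ →L[ℝ] Euc d₁ →L[ℝ] Euc d₁))
      (hρ.continuous_fderiv (by simp)) hbi.locallyIntegrable v
  have hex2 := hρc.convolutionExists_left (μ := (volume : Measure (Euc d₂)))
      (lsmul ℝ ℝ : ℝ →L[ℝ] (Euc d₂ →L[ℝ] Euc d₁) →L[ℝ] (Euc d₂ →L[ℝ] Euc d₁))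
      hρ.continuous hDi.locallyIntegrable v
  rw [convolution_eq_swap, convolution_eq_swap, ContinuousLinearMap.integral_apply hex1.integrable_swap,
    ContinuousLinearMap.integral_apply hex2.integrable_swap]
  -- The reflected, translated kernel is supported in the closed ball about v, hence in U, so it is
  -- admissible in the definition of the weak derivative.
  have hφ : ContDiff ℝ ∞ fun t => ρ (v - t) := hρ.comp (contDiff_const.sub contDiff_id)
  have hφs : tsupport (fun t => ρ (v - t)) ⊆ closedBall v φ.rOut := by
    refine closure_minimal (fun t ht => ?_) isClosed_closedBall
    have : v - t ∈ tsupport ρ := subset_tsupport _ ht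
    rw [hρdef, φ.tsupport_normed_eq, mem_closedBall_zero_iff] at this
    rwa [mem_closedBall, dist_comm, dist_eq_norm]
  have hφc : HasCompactSupport fun t => ρ (v - t) :=
    HasCompactSupport.of_support_subset_isCompact (isCompact_closedBall v φ.rOut)
      ((subset_tsupport _).trans hφs)
  have hd : ∀ t, fderiv ℝ (fun t => ρ (v - t)) t w = - fderiv ℝ ρ (v - t) w := fun t => by
    have h1 : HasFDerivAt (fun t : Euc d₂ => v - t) (-ContinuousLinearMap.id ℝ (Euc d₂)) t :=
      (hasFDerivAt_id t).const_sub v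
    have h2 := (hρ.differentiable (by simp) (v - t)).hasFDerivAt.comp t h1
    rw [show (fun t => ρ (v - t)) = ρ ∘ fun t => v - t from rfl, h2.fderiv]
    simp
  have key := hb.integral_eq _ hφ hφc (hφs.trans hv) w
  simp only [hd, neg_smul, integral_neg, neg_inj] at key
  rw [← integral_indicator hU, ← integral_indicator hU] at key
  convert key using 1
  · refine integral_congr_ae (Eventually.of_forall fun t => ?_)
    by_cases ht : t ∈ U <;> simp [ht, precompL_apply]
  · refine integral_congr_ae (Eventually.of_forall fun t => ?_)
    by_cases ht : t ∈ U <;> simp [ht]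

/-- Smooth approximations of a cutoff and of an `H¹` vector field near the support of the cutoff. -/
theorem HasH1Deriv.exists_smooth_approx {d₁ d₂ : ℕ} {R : ℝ}
    {b : Euc d₂ → Euc d₁} {Db : Euc d₂ → Euc d₂ →L[ℝ] Euc d₁} (hb : HasH1Deriv (ball 0 R) b Db)
    {ψ : Euc d₂ → ℝ} (hψ : ContDiff ℝ 1 ψ) (hψc : HasCompactSupport ψ)
    (hψs : tsupport ψ ⊆ ball 0 R) {P : ℝ} (hP : ∀ v, |ψ v| ≤ P) (hP' : ∀ v, ‖fderiv ℝ ψ v‖ ≤ P) :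
    ∃ (ψn : ℕ → Euc d₂ → ℝ) (bn : ℕ → Euc d₂ → Euc d₁) (Dn : ℕ → Euc d₂ → Euc d₂ →L[ℝ] Euc d₁),
      (∀ n, ContDiff ℝ ∞ (ψn n)) ∧ (∀ n, HasCompactSupport (ψn n)) ∧
      (∀ n, tsupport (ψn n) ⊆ ball 0 R) ∧ (∀ n v, |ψn n v| ≤ P) ∧
      (∀ n v, ‖fderiv ℝ (ψn n) v‖ ≤ P) ∧ (∀ v, Tendsto (fun n => ψn n v) atTop (𝓝 (ψ v))) ∧
      (∀ n, ContDiff ℝ ∞ (bn n)) ∧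
      (∀ᵐ v ∂volume.restrict (ball 0 R), Tendsto (fun n => bn n v) atTop (𝓝 (b v))) ∧
      (∀ n v, ψn n v ≠ 0 → fderiv ℝ (bn n) v = Dn n v) ∧
      (∀ n, AEStronglyMeasurable (Dn n) volume) ∧
      ∀ n, eLpNorm (Dn n) 2 volume ≤ eLpNorm Db 2 (volume.restrict (ball 0 R)) := by
  have hbi : Integrable ((ball 0 R).indicator b) :=
    MemLp.integrable_indicator measurableSet_ball measure_ball_lt_top.ne hb.memLp
  have hDi : Integrable ((ball 0 R).indicator Db) :=
    MemLp.integrable_indicator measurableSet_ball measure_ball_lt_top.ne hb.memLp_deriv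
  obtain ⟨c, hc0, hc⟩ := hψc.isCompact.exists_cthickening_subset_open isOpen_ball hψs
  -- The outer radius is at most c/2, so that two of them fit into the c-neighbourhood of the
  -- support of ψ. The fixed ratio 2 to the inner radius is what almost everywhere convergence of
  -- the mollified field requires.
  let φ : ℕ → ContDiffBump (0 : Euc d₂) := fun n =>
    ⟨c / 4 * ((n : ℝ) + 1)⁻¹, c / 2 * ((n : ℝ) + 1)⁻¹, by positivity, by gcongr; linarith⟩
  have hr0 : ∀ n, 0 < (φ n).rOut := fun n => (φ n).rOut_pos
  have hrc : ∀ n, (φ n).rOut + (φ n).rOut ≤ c := fun n => by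
    have : ((n : ℝ) + 1)⁻¹ ≤ 1 := inv_le_one_of_one_le₀ (by simp)
    simp only [φ]; nlinarith
  have hlim : Tendsto (fun n => (φ n).rOut) atTop (𝓝 0) := by
    have : Tendsto (fun n : ℕ => ((n : ℝ) + 1)⁻¹) atTop (𝓝 0) := tendsto_inv_atTop_zero.comp
      (tendsto_atTop_add_const_right _ _ tendsto_natCast_atTop_atTop)
    simpa [φ] using this.const_mul (c / 2)
  have hsupp : ∀ n v, ((φ n).normed volume ⋆[lsmul ℝ ℝ, volume] ψ) v ≠ 0 →
      v ∈ cthickening (φ n).rOut (tsupport ψ) := by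
    intro n v hv
    obtain ⟨s, hs, t, ht, rfl⟩ := support_convolution_subset (lsmul ℝ ℝ) hv
    rw [(φ n).support_normed_eq, mem_ball_zero_iff] at hs
    refine mem_cthickening_of_dist_le (s + t) t _ _ (subset_tsupport _ ht) ?_
    rw [dist_eq_norm, add_sub_cancel_right]; exact hs.le
  have htsupp : ∀ n, tsupport ((φ n).normed volume ⋆[lsmul ℝ ℝ, volume] ψ)
      ⊆ cthickening (φ n).rOut (tsupport ψ) := fun n =>
    closure_minimal (hsupp n) isClosed_cthickening
  refine ⟨fun n => (φ n).normed volume ⋆[lsmul ℝ ℝ, volume] ψ,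
    fun n => (φ n).normed volume ⋆[lsmul ℝ ℝ, volume] ((ball 0 R).indicator b),
    fun n => (φ n).normed volume ⋆[lsmul ℝ ℝ, volume] ((ball 0 R).indicator Db),
    fun n => (φ n).hasCompactSupport_normed.contDiff_convolution_left _ (φ n).contDiff_normed
      hψ.continuous.locallyIntegrable, fun n => ?_, fun n => ?_,
    fun n => norm_normed_convolution_le (φ n) hP,
    fun n => norm_fderiv_normed_convolution_le (φ n) hψ hP',
    fun v => ContDiffBump.convolution_tendsto_right_of_continuous hlim hψ.continuous v,
    fun n => (φ n).hasCompactSupport_normed.contDiff_convolution_left _ (φ n).contDiff_normed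
      hbi.locallyIntegrable, ?_, fun n v hv => ?_, fun n => ?_, fun n => ?_⟩
  · exact HasCompactSupport.of_support_subset_isCompact hψc.isCompact.cthickening (hsupp n)
  · exact (htsupp n).trans ((cthickening_mono (by linarith [hrc n, hr0 n]) _).trans hc)
  · have h1 := ContDiffBump.ae_convolution_tendsto_right_of_locallyIntegrable (K := 2) hlim
      (Eventually.of_forall fun n => by simp only [φ]; linarith) hbi.locallyIntegrable
    filter_upwards [ae_restrict_of_ae h1, ae_restrict_mem measurableSet_ball] with v h2 hv
    rwa [indicator_of_mem hv] at h2
  -- One outer radius separates v from the support of ψ, and a second is used by the kernel around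
  -- v; together they stay within c.
  · refine hb.fderiv_convolution measurableSet_ball measure_ball_lt_top.ne (φ n) ?_
    refine Subset.trans ?_ ((cthickening_mono (hrc n) _).trans hc)
    exact (closedBall_subset_cthickening (hsupp n v hv) _).trans
      (cthickening_cthickening_subset (hr0 n).le (hr0 n).le _)
  · exact ((φ n).hasCompactSupport_normed.continuous_convolution_left _ (φ n).continuous_normed
      hDi.locallyIntegrable).aestronglyMeasurable
  · exact eLpNorm_two_normed_convolution_indicator_le _ measurableSet_ball hDi.aestronglyMeasurable

end

/-! ### The regularised inverse of the symbol and its sublevel sets -/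

section

open scoped Topology
open Filter

section RegularizedInverse

variable {δ : ℝ}

/-- This function stands in for 1/a. Its bound 1/δ and its derivative bound 1/δ² determine the cost
of the test function η. -/
theorem contDiff_regularizedInverse (hδ : 0 < δ) :
    ContDiff ℝ ∞ fun a : ℝ => a / (a ^ 2 + δ ^ 2) :=
  contDiff_id.div (by fun_prop) fun a => by positivity

theorem abs_regularizedInverse_le (hδ : 0 < δ) (a : ℝ) : |a / (a ^ 2 + δ ^ 2)| ≤ 1 / δ := by
  rw [abs_div, abs_of_pos (show 0 < a ^ 2 + δ ^ 2 by positivity), div_le_div_iff₀ (by positivity) hδ,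
    ← sq_abs a]
  nlinarith [sq_nonneg (|a| - δ), abs_nonneg a, sq_nonneg |a|, sq_nonneg δ]

theorem hasDerivAt_regularizedInverse (hδ : 0 < δ) (a : ℝ) :
    HasDerivAt (fun a : ℝ => a / (a ^ 2 + δ ^ 2))
      ((δ ^ 2 - a ^ 2) / (a ^ 2 + δ ^ 2) ^ 2) a := by
  have h := (hasDerivAt_id a).div (((hasDerivAt_id a).pow 2).add_const (δ ^ 2))
    (show a ^ 2 + δ ^ 2 ≠ 0 by positivity)
  refine HasDerivAt.congr_deriv (f := fun a : ℝ => a / (a ^ 2 + δ ^ 2)) h ?_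
  simp only [id, Pi.pow_apply]
  congr 1
  norm_num
  ring

theorem abs_deriv_regularizedInverse_le (hδ : 0 < δ) (a : ℝ) :
    |(δ ^ 2 - a ^ 2) / (a ^ 2 + δ ^ 2) ^ 2| ≤ 1 / δ ^ 2 := by
  rw [abs_div, abs_of_pos (show 0 < (a ^ 2 + δ ^ 2) ^ 2 by positivity),
    div_le_div_iff₀ (by positivity) (by positivity)]
  have h1 : |δ ^ 2 - a ^ 2| ≤ a ^ 2 + δ ^ 2 := by
    rw [abs_le]; constructor <;> nlinarith [sq_nonneg a, sq_nonneg δ]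
  calc |δ ^ 2 - a ^ 2| * δ ^ 2 ≤ (a ^ 2 + δ ^ 2) * (a ^ 2 + δ ^ 2) := by
        gcongr; nlinarith [sq_nonneg a]
    _ = _ := by ring

end RegularizedInverse

/-- Test functions approximating `ψ A / (A² + δ²)`, where `A = τ + b · ξ` is the transport symbol. -/
theorem HasH1Deriv.exists_test_sequence {d₁ d₂ : ℕ} {R : ℝ}
    {b : Euc d₂ → Euc d₁} {Db : Euc d₂ → Euc d₂ →L[ℝ] Euc d₁} (hb : HasH1Deriv (ball 0 R) b Db)
    {ψ : Euc d₂ → ℝ} (hψ : ContDiff ℝ 1 ψ) (hψc : HasCompactSupport ψ)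
    (hψs : tsupport ψ ⊆ ball 0 R) {P : ℝ} (hP : ∀ v, |ψ v| ≤ P) (hP' : ∀ v, ‖fderiv ℝ ψ v‖ ≤ P)
    (τ : ℝ) (ξ : Euc d₁) {δ : ℝ} (hδ : 0 < δ) :
    ∃ η : ℕ → Euc d₂ → ℝ, (∀ n, ContDiff ℝ ∞ (η n)) ∧ (∀ n, HasCompactSupport (η n)) ∧
      (∀ n, tsupport (η n) ⊆ ball 0 R) ∧ (∀ n v, |η n v| ≤ P * (1 / δ)) ∧
      (∀ᵐ v ∂volume.restrict (ball 0 R), Tendsto (fun n => η n v) atTop (𝓝 (ψ v *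
        ((τ + inner ℝ (b v) ξ) / ((τ + inner ℝ (b v) ξ) ^ 2 + δ ^ 2))))) ∧
      ∀ n, eLpNorm (fderiv ℝ (η n)) 2 (volume.restrict (ball 0 R)) ≤
        volume.restrict (ball (0 : Euc d₂) R) univ ^ (1 / 2 : ℝ) * ENNReal.ofReal (P * (1 / δ)) +
        ENNReal.ofReal (P * (1 / δ ^ 2) * ‖ξ‖) *
          eLpNorm Db 2 (volume.restrict (ball 0 R)) := by
  have hP0 : 0 ≤ P := (abs_nonneg _).trans (hP 0)
  obtain ⟨ψn, bn, Dn, hψn, hψnc, hψns, hψnP, hψnP', hψnl, hbn, hbnl, hD, hDm, hDn⟩ :=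
    hb.exists_smooth_approx hψ hψc hψs hP hP'
  set Φ : ℝ → ℝ := fun a => a / (a ^ 2 + δ ^ 2) with hΦ
  have hΦs : ContDiff ℝ ∞ Φ := contDiff_regularizedInverse hδ
  have hA : ∀ n, ContDiff ℝ ∞ fun v => τ + inner ℝ (bn n v) ξ := fun n =>
    contDiff_const.add ((hbn n).inner ℝ contDiff_const)
  refine ⟨fun n v => ψn n v * Φ (τ + inner ℝ (bn n v) ξ), fun n => (hψn n).mul (hΦs.comp (hA n)),
    fun n => (hψnc n).mul_right, fun n => (tsupport_mul_subset_left).trans (hψns n),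
    fun n v => ?_, ?_, fun n => ?_⟩
  · rw [abs_mul]
    exact mul_le_mul (hψnP n v) (abs_regularizedInverse_le hδ _) (abs_nonneg _) hP0
  · filter_upwards [hbnl] with v hv
    have h1 : Tendsto (fun n => τ + inner ℝ (bn n v) ξ) atTop (𝓝 (τ + inner ℝ (b v) ξ)) :=
      tendsto_const_nhds.add (hv.inner tendsto_const_nhds)
    exact (hψnl v).mul ((hΦs.continuous.tendsto _).comp h1)
  · have hbound : ∀ v, ‖fderiv ℝ (fun v => ψn n v * Φ (τ + inner ℝ (bn n v) ξ)) v‖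
        ≤ ‖P * (1 / δ) + P * (1 / δ ^ 2) * ‖ξ‖ * ‖Dn n v‖‖ := by
      intro v
      rw [Real.norm_of_nonneg (by positivity)]
      refine ContinuousLinearMap.opNorm_le_bound _ (by positivity) fun w => ?_
      have h1 := ((hψn n).differentiable (by simp) v).hasFDerivAt
      have h2 := ((hbn n).differentiable (by simp) v).hasFDerivAt
      have h3 : HasFDerivAt (fun v => τ + inner ℝ (bn n v) ξ) _ v :=
        (h2.inner ℝ (hasFDerivAt_const ξ v)).const_add τ
      have h4 := (hasDerivAt_regularizedInverse hδ (τ + inner ℝ (bn n v) ξ)).comp_hasFDerivAt v h3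
      have h5 : fderiv ℝ (fun v => ψn n v * Φ (τ + inner ℝ (bn n v) ξ)) v w
          = fderiv ℝ (ψn n) v w * Φ (τ + inner ℝ (bn n v) ξ) + ψn n v *
            ((δ ^ 2 - (τ + inner ℝ (bn n v) ξ) ^ 2) /
              ((τ + inner ℝ (bn n v) ξ) ^ 2 + δ ^ 2) ^ 2 * inner ℝ (fderiv ℝ (bn n) v w) ξ) := by
        rw [show (fun v => ψn n v * Φ (τ + inner ℝ (bn n v) ξ)) = ψn n *
          ((fun a : ℝ => a / (a ^ 2 + δ ^ 2)) ∘ fun v => τ + inner ℝ (bn n v) ξ) from rfl,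
          (h1.mul h4).fderiv]
        simp [hΦ, fderivInnerCLM_apply]
        ring
      rw [h5, add_mul]
      refine (norm_add_le _ _).trans (add_le_add ?_ ?_)
      · rw [norm_mul, mul_right_comm]
        refine mul_le_mul ?_ (abs_regularizedInverse_le hδ _) (norm_nonneg _) (by positivity)
        exact (ContinuousLinearMap.le_opNorm _ _).trans
          (mul_le_mul_of_nonneg_right (hψnP' n v) (norm_nonneg _))
      -- The derivative of `bn n` is identified with `Dn n` only where `ψn n` is nonzero; elsewhere
      -- this term vanishes.
      · by_cases h0 : ψn n v = 0
        · rw [h0, zero_mul, norm_zero]; positivity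
        rw [hD n v h0, norm_mul, norm_mul]
        have h6 : ‖(inner ℝ (Dn n v w) ξ : ℝ)‖ ≤ ‖Dn n v‖ * ‖w‖ * ‖ξ‖ :=
          (norm_inner_le_norm _ _).trans
            (mul_le_mul_of_nonneg_right (ContinuousLinearMap.le_opNorm _ _) (norm_nonneg _))
        calc _ ≤ P * (1 / δ ^ 2 * (‖Dn n v‖ * ‖w‖ * ‖ξ‖)) := by
              refine mul_le_mul (hψnP n v) ?_ (by positivity) hP0
              exact mul_le_mul (abs_deriv_regularizedInverse_le hδ _) h6 (norm_nonneg _)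
                (by positivity)
          _ = _ := by ring
    refine (eLpNorm_mono hbound).trans ?_
    refine (eLpNorm_add_le (f := fun _ => P * (1 / δ))
      (g := fun v => P * (1 / δ ^ 2) * ‖ξ‖ * ‖Dn n v‖) aestronglyMeasurable_const
      ((hDm n).norm.const_mul _).restrict (by norm_num)).trans (add_le_add ?_ ?_)
    · refine (eLpNorm_le_of_ae_bound (C := P * (1 / δ)) (Eventually.of_forall fun v => ?_)).trans ?_
      · rw [Real.norm_of_nonneg (by positivity)]
      · norm_num
    · have h7 := eLpNorm_const_smul (P * (1 / δ ^ 2) * ‖ξ‖) (fun v => ‖Dn n v‖) 2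
        (volume.restrict (ball 0 R))
      have h8 : eLpNorm (fun v => P * (1 / δ ^ 2) * ‖ξ‖ * ‖Dn n v‖) 2
          (volume.restrict (ball 0 R)) = _ := h7
      rw [h8, eLpNorm_norm, Real.enorm_of_nonneg (by positivity)]
      gcongr
      exact (eLpNorm_mono_measure _ Measure.restrict_le_self).trans (hDn n)

/-- Sublevel sets of the transport symbol are small, uniformly over all frequencies. -/
theorem IsNondegenerate.measure_symbol_le {d₁ d₂ : ℕ} {R K α M : ℝ} {b : Euc d₂ → Euc d₁}
    (hK : 0 ≤ K) (hα : 0 < α) (hα1 : α ≤ 1) (hM : 0 ≤ M) (h : IsNondegenerate R K α b)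
    (hb : ∀ᵐ v ∂volume.restrict (ball 0 R), ‖b v‖ ≤ M) (τ : ℝ) (ξ : Euc d₁) {N : ℝ} (hN : 0 < N)
    (hN2 : N ^ 2 = τ ^ 2 + ‖ξ‖ ^ 2) {s : ℝ} (hs : 0 < s) :
    volume.restrict (ball 0 R) {v | |τ + inner ℝ (b v) ξ| ≤ s * N} ≤
      ENNReal.ofReal ((4 * (1 + M) * K + 2 * volume.real (ball (0 : Euc d₂) R)) * s ^ α) := by
  -- The threshold separates two regimes. If |ξ| ≥ cN, dividing by |ξ| reduces to the nondegeneracy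
  -- condition. Otherwise |b·ξ| ≤ McN ≤ N/4 while |τ| ≥ 3N/4, so the symbol is at least N/2 in size.
  set c : ℝ := (4 * (1 + M))⁻¹ with hc
  have hc0 : 0 < c := by positivity
  have hc1 : c ≤ 1 := inv_le_one_of_one_le₀ (by linarith)
  have hsα : 0 ≤ s ^ α := (Real.rpow_pos_of_pos hs α).le
  have hvol : 0 ≤ volume.real (ball (0 : Euc d₂) R) := measureReal_nonneg
  rcases le_or_gt (c * N) ‖ξ‖ with hξ | hξ
  · have hξ0 : 0 < ‖ξ‖ := (by positivity : 0 < c * N).trans_le hξ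
    have h1 := h (τ / ‖ξ‖) (‖ξ‖⁻¹ • ξ) (by
      rw [mem_sphere_zero_iff_norm, norm_smul, norm_inv, norm_norm, inv_mul_cancel₀ hξ0.ne'])
      (s / c) (by positivity)
    have hsub : {v | |τ + inner ℝ (b v) ξ| ≤ s * N} ∩ ball 0 R ⊆
        {v ∈ ball (0 : Euc d₂) R | |τ / ‖ξ‖ + inner ℝ (b v) (‖ξ‖⁻¹ • ξ)| ≤ s / c} := by
      rintro v ⟨hv, hvR⟩
      refine ⟨hvR, ?_⟩
      rw [inner_smul_right, show τ / ‖ξ‖ + ‖ξ‖⁻¹ * inner ℝ (b v) ξ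
        = (τ + inner ℝ (b v) ξ) / ‖ξ‖ by field_simp, abs_div, abs_norm, div_le_div_iff₀ hξ0 hc0]
      calc |τ + inner ℝ (b v) ξ| * c ≤ s * N * c := by gcongr; exact hv
        _ = s * (c * N) := by ring
        _ ≤ s * ‖ξ‖ := by gcongr
    rw [Measure.restrict_apply₀' measurableSet_ball.nullMeasurableSet]
    refine (measure_mono hsub).trans (h1.trans (ENNReal.ofReal_le_ofReal ?_))
    -- Together with c ≤ 1, the assumption α ≤ 1 removes α from the constant.
    have hcα : c ≤ c ^ α := by
      simpa using Real.rpow_le_rpow_of_exponent_ge hc0 hc1 hα1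
    have h2 : (s / c) ^ α ≤ 4 * (1 + M) * s ^ α := by
      rw [Real.div_rpow hs.le hc0.le, div_le_iff₀ (by positivity)]
      calc s ^ α = 4 * (1 + M) * s ^ α * c := by rw [hc]; field_simp
        _ ≤ _ := by gcongr
    calc K * (s / c) ^ α ≤ K * (4 * (1 + M) * s ^ α) := by gcongr
      _ ≤ _ := by nlinarith [mul_nonneg hvol hsα]
  · have hτ : 3 / 4 * N ≤ |τ| := by
      have hcq : c ≤ 1 / 4 := by
        rw [hc, inv_le_comm₀ (by positivity) (by norm_num)]; linarith
      have h1 : ‖ξ‖ ≤ 1 / 4 * N := hξ.le.trans (by gcongr)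
      refine abs_le_of_sq_le_sq' ?_ (abs_nonneg _) |>.2
      rw [sq_abs]
      nlinarith [norm_nonneg ξ]
    have hlow : ∀ᵐ v ∂volume.restrict (ball 0 R), N / 2 ≤ |τ + inner ℝ (b v) ξ| := by
      filter_upwards [hb] with v hv
      have h1 : |(inner ℝ (b v) ξ : ℝ)| ≤ M * (c * N) :=
        (abs_real_inner_le_norm _ _).trans (mul_le_mul hv hξ.le (norm_nonneg _) hM)
      have h2 : M * c ≤ 1 / 4 := by
        rw [hc, ← div_eq_mul_inv, div_le_iff₀ (by positivity)]; linarith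
      have h3 : |τ| - |(inner ℝ (b v) ξ : ℝ)| ≤ |τ + inner ℝ (b v) ξ| := by
        have := abs_sub_abs_le_abs_sub τ (-(inner ℝ (b v) ξ : ℝ))
        rwa [abs_neg, sub_neg_eq_add] at this
      nlinarith
    -- Below 1/2 the sublevel set is null. From 1/2 on, s^α ≥ 1/2, so twice the volume of the ball
    -- suffices.
    rcases lt_or_ge s (1 / 2) with hs2 | hs2
    · have : volume.restrict (ball 0 R) {v | |τ + inner ℝ (b v) ξ| ≤ s * N} = 0 := by
        refine measure_mono_null ?_ (ae_iff.1 hlow)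
        intro v hv
        simp only [mem_ofPred_eq, not_le] at hv ⊢
        nlinarith
      rw [this]; exact zero_le
    · refine (measure_mono (subset_univ _)).trans ?_
      rw [Measure.restrict_apply_univ, ← ofReal_measureReal measure_ball_lt_top.ne]
      refine ENNReal.ofReal_le_ofReal ?_
      have h1 : 1 / 2 ≤ s ^ α := by
        calc (1 / 2 : ℝ) = (1 / 2 : ℝ) ^ (1 : ℝ) := by norm_num
          _ ≤ (1 / 2 : ℝ) ^ α :=
            Real.rpow_le_rpow_of_exponent_ge (by norm_num) (by norm_num) hα1
          _ ≤ s ^ α := Real.rpow_le_rpow (by norm_num) hs2 hα.le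
      have h2 : 0 ≤ 4 * (1 + M) * K * s ^ α := by positivity
      nlinarith

/-- The dyadic estimate of the part of the integral where the symbol is small. -/
theorem lintegral_regularized_le {V : Type*} [MeasurableSpace V] {μ : Measure V} {A : V → ℝ}
    (hA : AEMeasurable A μ) {C N α ε : ℝ} (hC : 0 ≤ C) (hN : 0 < N) (hα1 : α ≤ 1)
    (hε : 0 < ε)
    (h : ∀ s : ℝ, 0 < s → μ {v | |A v| ≤ s * N} ≤ ENNReal.ofReal (C * s ^ α)) :
    ∫⁻ v, ‖(ε * N) ^ 2 / (A v ^ 2 + (ε * N) ^ 2)‖ₑ ^ 2 ∂μ ≤ ENNReal.ofReal (32 * C * ε ^ α) := by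
  set δ := ε * N with hδ
  have hδ0 : 0 < δ := by positivity
  have hS : ∀ k : ℕ, NullMeasurableSet {v | |A v| ≤ 2 ^ k * δ} μ := fun k =>
    nullMeasurableSet_le hA.norm aemeasurable_const
  -- At the least k with |A| ≤ 2^k δ, minimality gives |A| > 2^(k-1) δ if k > 0, so the squared
  -- weight is at most 16^(-(k-1)). The factor 16 absorbs this shift and also covers k = 0, where
  -- the weight is at most 1.
  set f : ℕ → V → ℝ≥0∞ := fun k =>
    {v | |A v| ≤ 2 ^ k * δ}.indicator fun _ => ENNReal.ofReal (16 * (1 / 16) ^ k) with hf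
  have hpt : ∀ v, ‖δ ^ 2 / (A v ^ 2 + δ ^ 2)‖ₑ ^ 2 ≤ ∑' k, f k v := by
    intro v
    have hex : ∃ k : ℕ, |A v| ≤ 2 ^ k * δ := by
      obtain ⟨k, hk⟩ := pow_unbounded_of_one_lt (|A v| / δ) one_lt_two
      exact ⟨k, by rw [div_lt_iff₀ hδ0] at hk; exact hk.le⟩
    classical
    refine le_trans ?_ (ENNReal.le_tsum (Nat.find hex))
    have hk := Nat.find_spec hex
    simp only [hf]
    rw [indicator_of_mem (by exact hk), Real.enorm_of_nonneg (by positivity),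
      ← ENNReal.ofReal_pow (by positivity)]
    refine ENNReal.ofReal_le_ofReal ?_
    rcases hcase : Nat.find hex with _ | j
    · have : δ ^ 2 / (A v ^ 2 + δ ^ 2) ≤ 1 := by
        rw [div_le_one (by positivity)]; nlinarith [sq_nonneg (A v)]
      calc (δ ^ 2 / (A v ^ 2 + δ ^ 2)) ^ 2 ≤ 1 := pow_le_one₀ (by positivity) this
        _ ≤ _ := by norm_num
    · have hj := Nat.find_min hex (m := j) (by omega)
      rw [not_le] at hj
      have h2 : δ ^ 2 / (A v ^ 2 + δ ^ 2) ≤ (1 / 4) ^ j := by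
        have h3 : (2 ^ j * δ) ^ 2 ≤ A v ^ 2 := by
          rw [← sq_abs (A v)]; gcongr
        rw [div_le_iff₀ (by positivity)]
        calc δ ^ 2 = (1 / 4) ^ j * (2 ^ j * δ) ^ 2 := by
              rw [mul_pow (2 ^ j) δ 2, ← pow_mul, mul_comm j 2, pow_mul, ← mul_assoc, ← mul_pow]; norm_num
          _ ≤ _ := by gcongr; nlinarith [sq_nonneg δ]
      calc (δ ^ 2 / (A v ^ 2 + δ ^ 2)) ^ 2 ≤ ((1 / 4) ^ j) ^ 2 := by gcongr
        _ = 16 * (1 / 16) ^ (j + 1) := by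
          rw [← pow_mul, mul_comm j 2, pow_mul, pow_succ]; norm_num; ring
  have hterm : ∀ k, ∫⁻ v, f k v ∂μ ≤ ENNReal.ofReal (16 * C * ε ^ α * (1 / 8) ^ k) := by
    intro k
    simp only [hf]
    rw [lintegral_indicator₀ (hS k), setLIntegral_const]
    have h1 := h (2 ^ k * ε) (by positivity)
    rw [mul_assoc, ← hδ] at h1
    refine (mul_le_mul_right h1 _).trans ?_
    rw [← ENNReal.ofReal_mul (by positivity)]
    refine ENNReal.ofReal_le_ofReal ?_
    -- Since α ≤ 1 the measure grows at most like 2^k against the decay 16^(-k). The ratio is 1/8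
    -- whatever α is, and 16 · 8/7 ≤ 32.
    have h2 : ((2 : ℝ) ^ k) ^ α ≤ 2 ^ k := by
      simpa using Real.rpow_le_rpow_of_exponent_le (one_le_pow₀ (one_le_two (α := ℝ))) hα1
    rw [Real.mul_rpow (by positivity) hε.le]
    calc 16 * (1 / 16) ^ k * (C * ((2 ^ k) ^ α * ε ^ α))
        ≤ 16 * (1 / 16) ^ k * (C * (2 ^ k * ε ^ α)) := by gcongr
      _ = 16 * C * ε ^ α * ((1 / 16) ^ k * 2 ^ k) := by ring
      _ = _ := by rw [← mul_pow]; norm_num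
  calc _ ≤ ∫⁻ v, ∑' k, f k v ∂μ := lintegral_mono hpt
    _ = ∑' k, ∫⁻ v, f k v ∂μ :=
        lintegral_tsum fun k => (aemeasurable_const).indicator₀ (hS k)
    _ ≤ ∑' k : ℕ, ENNReal.ofReal (16 * C * ε ^ α * (1 / 8) ^ k) := ENNReal.tsum_le_tsum hterm
    _ = ENNReal.ofReal (∑' k : ℕ, 16 * C * ε ^ α * (1 / 8) ^ k) :=
        (ENNReal.ofReal_tsum_of_nonneg (fun k => by positivity)
          ((summable_geometric_of_lt_one (by norm_num) (by norm_num)).mul_left _)).symm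
    _ ≤ _ := by
        refine ENNReal.ofReal_le_ofReal ?_
        rw [tsum_mul_left, tsum_geometric_of_lt_one (by norm_num) (by norm_num)]
        have : 0 ≤ C * ε ^ α := by positivity
        nlinarith

end

/-! ### Phase space as a product, and tensor product test functions -/

section

open scoped Topology FourierTransform
open Filter

/-- Phase space as the product of space-time and velocity space. -/
noncomputable def phaseEquiv (d₁ d₂ : ℕ) : SpaceTime d₁ × Euc d₂ ≃ᵐ ℝ × Euc d₁ × Euc d₂ :=
  ((MeasurableEquiv.toLp 2 (ℝ × Euc d₁)).symm.prodCongr (MeasurableEquiv.refl _)).trans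
    MeasurableEquiv.prodAssoc

theorem phaseEquiv_apply {d₁ d₂ : ℕ} (p : SpaceTime d₁ × Euc d₂) :
    phaseEquiv d₁ d₂ p = (p.1.fst, p.1.snd, p.2) := rfl

/-- Giving space-time its Hilbert norm leaves Lebesgue measure unchanged, and the restriction
concerns the velocity factor only. -/
theorem measurePreserving_phaseEquiv (d₁ d₂ : ℕ) (R : ℝ) :
    MeasurePreserving (phaseEquiv d₁ d₂)
      ((volume : Measure (SpaceTime d₁)).prod (volume.restrict (ball (0 : Euc d₂) R)))
      (volume.restrict (phaseDomain d₁ d₂ R)) := by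
  have h1 : MeasurePreserving ((MeasurableEquiv.toLp 2 (ℝ × Euc d₁)).symm.prodCongr
      (MeasurableEquiv.refl (Euc d₂)))
      ((volume : Measure (SpaceTime d₁)).prod (volume.restrict (ball (0 : Euc d₂) R)))
      (((volume : Measure ℝ).prod (volume : Measure (Euc d₁))).prod
        (volume.restrict (ball (0 : Euc d₂) R))) :=
    (WithLp.volume_preserving_ofLp ℝ (Euc d₁)).prod (MeasurePreserving.id _)
  have h2 := measurePreserving_prodAssoc (volume : Measure ℝ) (volume : Measure (Euc d₁))
    (volume.restrict (ball (0 : Euc d₂) R))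
  have h3 : volume.restrict (phaseDomain d₁ d₂ R) = (volume : Measure ℝ).prod
      ((volume : Measure (Euc d₁)).prod (volume.restrict (ball (0 : Euc d₂) R))) := by
    rw [phaseDomain, Measure.volume_eq_prod, Measure.volume_eq_prod, ← Measure.prod_restrict,
      ← Measure.prod_restrict, Measure.restrict_univ, Measure.restrict_univ]
  rw [h3]
  exact h1.trans h2

/-- The transport equation tested against tensor products. -/
theorem IsTransportSolution.tensor {d₁ d₂ : ℕ} {R : ℝ} {b : Euc d₂ → Euc d₁}
    {h : ℝ × Euc d₁ × Euc d₂ → ℝ} {g₁ : ℝ × Euc d₁ × Euc d₂ → Euc d₂}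
    {g₀ : ℝ × Euc d₁ × Euc d₂ → ℝ} (hsol : IsTransportSolution R b h g₁ g₀)
    {χ : SpaceTime d₁ → ℝ} (hχ : ContDiff ℝ ∞ χ) (hχc : HasCompactSupport χ)
    {η : Euc d₂ → ℝ} (hη : ContDiff ℝ ∞ η) (hηc : HasCompactSupport η)
    (hηs : tsupport η ⊆ ball 0 R) :
    - ∫ p, h (phaseEquiv d₁ d₂ p) * (fderiv ℝ χ p.1 (WithLp.toLp 2 (1, b p.2)) * η p.2)
        ∂((volume : Measure (SpaceTime d₁)).prod (volume.restrict (ball (0 : Euc d₂) R))) =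
      - (∫ p, χ p.1 * fderiv ℝ η p.2 (g₁ (phaseEquiv d₁ d₂ p))
        ∂((volume : Measure (SpaceTime d₁)).prod (volume.restrict (ball (0 : Euc d₂) R)))) +
      ∫ p, g₀ (phaseEquiv d₁ d₂ p) * (χ p.1 * η p.2)
        ∂((volume : Measure (SpaceTime d₁)).prod (volume.restrict (ball (0 : Euc d₂) R))) := by
  let T : (ℝ × Euc d₁ × Euc d₂) →L[ℝ] SpaceTime d₁ :=
    (WithLp.prodContinuousLinearEquiv 2 ℝ ℝ (Euc d₁)).symm.toContinuousLinearMap.comp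
      ((ContinuousLinearMap.fst ℝ ℝ (Euc d₁ × Euc d₂)).prod
        ((ContinuousLinearMap.fst ℝ (Euc d₁) (Euc d₂)).comp
          (ContinuousLinearMap.snd ℝ ℝ (Euc d₁ × Euc d₂))))
  let S : (ℝ × Euc d₁ × Euc d₂) →L[ℝ] Euc d₂ :=
    (ContinuousLinearMap.snd ℝ (Euc d₁) (Euc d₂)).comp
      (ContinuousLinearMap.snd ℝ ℝ (Euc d₁ × Euc d₂))
  have hT : ∀ q, T q = WithLp.toLp 2 (q.1, q.2.1) := fun q => rfl
  have hS : ∀ q, S q = q.2.2 := fun q => rfl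
  set φ : ℝ × Euc d₁ × Euc d₂ → ℝ := fun q => χ (T q) * η (S q) with hφ
  have hφs : ContDiff ℝ ∞ φ := (hχ.comp T.contDiff).mul (hη.comp S.contDiff)
  have hTc : Continuous fun p : SpaceTime d₁ × Euc d₂ => (p.1.fst, p.1.snd, p.2) := by fun_prop
  have hφc : HasCompactSupport φ := by
    refine HasCompactSupport.of_support_subset_isCompact
      ((hχc.isCompact.prod hηc.isCompact).image hTc) fun q hq => ?_
    have h1 : χ (T q) ≠ 0 := fun h0 => hq (by simp [hφ, h0])
    have h2 : η (S q) ≠ 0 := fun h0 => hq (by simp [hφ, h0])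
    exact ⟨(T q, S q), ⟨subset_tsupport _ h1, subset_tsupport _ h2⟩, rfl⟩
  have hφt : tsupport φ ⊆ phaseDomain d₁ d₂ R := by
    have : tsupport φ ⊆ S ⁻¹' tsupport η := by
      refine closure_minimal (fun q hq => ?_) ((isClosed_tsupport η).preimage S.continuous)
      exact subset_tsupport _ fun h0 => hq (by simp [hφ, h0])
    exact fun q hq => ⟨mem_univ _, mem_univ _, hηs (this hq)⟩
  have hd : ∀ q w, fderiv ℝ φ q w = fderiv ℝ χ (T q) (T w) * η (S q)
      + χ (T q) * fderiv ℝ η (S q) (S w) := by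
    intro q w
    have h1 := (hχ.differentiable (by simp) (T q)).hasFDerivAt.comp q T.hasFDerivAt
    have h2 := (hη.differentiable (by simp) (S q)).hasFDerivAt.comp q S.hasFDerivAt
    rw [show φ = (χ ∘ T) * (η ∘ S) from rfl, (h1.mul h2).fderiv]
    simp
    ring
  have key := hsol φ hφs hφc hφt
  have he := measurePreserving_phaseEquiv d₁ d₂ R
  rw [← he.integral_comp', ← he.integral_comp', ← he.integral_comp'] at key
  have e1 : ∀ p : SpaceTime d₁ × Euc d₂, fderiv ℝ φ (phaseEquiv d₁ d₂ p)
      (1, b (phaseEquiv d₁ d₂ p).2.2, 0) = fderiv ℝ χ p.1 (WithLp.toLp 2 (1, b p.2)) * η p.2 := by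
    intro p
    rw [hd, show S (1, b (phaseEquiv d₁ d₂ p).2.2, 0) = 0 from rfl, map_zero, mul_zero, add_zero]
    rfl
  have e2 : ∀ p : SpaceTime d₁ × Euc d₂, fderiv ℝ φ (phaseEquiv d₁ d₂ p)
      (0, 0, g₁ (phaseEquiv d₁ d₂ p)) = χ p.1 * fderiv ℝ η p.2 (g₁ (phaseEquiv d₁ d₂ p)) := by
    intro p
    rw [hd, show T (0, 0, g₁ (phaseEquiv d₁ d₂ p)) = 0 from rfl, map_zero, zero_mul, zero_add]
    rfl
  simp only [e1, e2] at key
  exact key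

section RealToL2

variable {V : Type*} [MeasurableSpace V] {μ : Measure V}

open Classical in
/-- The class in complex `L²` of a real function, zero if the function is not square integrable. -/
noncomputable def realToL2 (μ : Measure V) (a : V → ℝ) : Lp ℂ 2 μ :=
  if h : MemLp (fun v => (a v : ℂ)) 2 μ then h.toLp _ else 0

theorem realToL2_coe {a : V → ℝ} (ha : MemLp a 2 μ) : realToL2 μ a =ᵐ[μ] fun v => (a v : ℂ) := by
  have h : MemLp (fun v => (a v : ℂ)) 2 μ := ha.ofReal
  simp only [realToL2, dif_pos h]
  exact h.coeFn_toLp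

/-- Because a is real, no conjugate appears: integration against a is a continuous complex linear
functional, to which commutation with the Fourier transform applies. -/
theorem inner_realToL2 {a : V → ℝ} (ha : MemLp a 2 μ) (u : Lp ℂ 2 μ) :
    inner ℂ (realToL2 μ a) u = ∫ v, (a v : ℂ) * u v ∂μ := by
  rw [L2.inner_def]
  refine integral_congr_ae ?_
  filter_upwards [realToL2_coe ha] with v hv
  rw [hv, RCLike.inner_apply, Complex.conj_ofReal, mul_comm]

theorem norm_realToL2 {a : V → ℝ} (ha : MemLp a 2 μ) :
    ‖realToL2 μ a‖ = (eLpNorm a 2 μ).toReal := by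
  rw [Lp.norm_def, eLpNorm_congr_ae (realToL2_coe ha)]
  congr 1
  exact eLpNorm_congr_norm_ae (Eventually.of_forall fun v => by simp)

theorem integrable_ofReal_mul_L2 {a : V → ℝ} (ha : MemLp a 2 μ) (u : Lp ℂ 2 μ) :
    Integrable (fun v => (a v : ℂ) * u v) μ :=
  (MemLp.ofReal ha : MemLp (fun v => (a v : ℂ)) 2 μ).integrable_mul (Lp.memLp u)

theorem memLp_two_tensor {Z : Type*} [MeasurableSpace Z] {ν : Measure Z} [SFinite ν] [SFinite μ]
    {κ : Z → ℝ} {a : V → ℝ} (hκ : MemLp κ 2 ν) (ha : MemLp a 2 μ) :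
    MemLp (fun p : Z × V => κ p.1 * a p.2) 2 (ν.prod μ) := by
  refine (memLp_two_iff_integrable_sq (hκ.1.comp_fst.mul ha.1.comp_snd)).2 ?_
  have := ((memLp_two_iff_integrable_sq hκ.1).1 hκ).mul_prod
    ((memLp_two_iff_integrable_sq ha.1).1 ha)
  exact this.congr (Eventually.of_forall fun p => by simp [mul_pow])

theorem integrable_tensor_mul {Z : Type*} [MeasurableSpace Z] {ν : Measure Z} [SFinite ν]
    [SFinite μ] {κ : Z → ℝ} {a : V → ℝ} {f : Z × V → ℝ} (hκ : MemLp κ 2 ν) (ha : MemLp a 2 μ)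
    (hf : MemLp f 2 (ν.prod μ)) :
    Integrable (fun p : Z × V => κ p.1 * a p.2 * f p) (ν.prod μ) :=
  (memLp_two_tensor hκ ha).integrable_mul hf

/-- Pairing with a tensor product through the vector valued representative. -/
theorem integral_inner_curry {Z : Type*} [MeasurableSpace Z] {ν : Measure Z} [SFinite ν]
    [SFinite μ] {f : Z × V → ℝ} (hf : MemLp f 2 (ν.prod μ)) {F : Z → Lp ℂ 2 μ}
    (hF : ∀ᵐ z ∂ν, F z =ᵐ[μ] fun v => (f (z, v) : ℂ)) {κ : Z → ℝ} {a : V → ℝ}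
    (hκ : MemLp κ 2 ν) (ha : MemLp a 2 μ) :
    ∫ z, (κ z : ℂ) * inner ℂ (realToL2 μ a) (F z) ∂ν
      = ((∫ p, κ p.1 * a p.2 * f p ∂(ν.prod μ) : ℝ) : ℂ) := by
  rw [← integral_complex_ofReal, integral_prod _ (integrable_tensor_mul hκ ha hf).ofReal]
  refine integral_congr_ae ?_
  filter_upwards [hF] with z hz
  rw [inner_realToL2 ha, ← integral_const_mul]
  refine integral_congr_ae ?_
  filter_upwards [hz] with v hv
  simp [hv, mul_assoc]

end RealToL2

end

/-! ### The transport equation on the Fourier side -/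

section

open scoped Topology FourierTransform
open Filter

/-- The coordinate directions of space-time. -/
noncomputable def spaceTimeDir (d₁ : ℕ) : Option (Fin d₁) → SpaceTime d₁
  | none => WithLp.toLp 2 (1, 0)
  | some i => WithLp.toLp 2 (0, EuclideanSpace.single i 1)

/-- The coefficients of the transport operator `∂_t + b · ∇_x`. -/
def transportCoeff {d₁ d₂ : ℕ} (b : Euc d₂ → Euc d₁) (v : Euc d₂) : Option (Fin d₁) → ℝ
  | none => 1
  | some i => b v i

/-- The v-dependent transport direction is resolved into constant directions with v-dependent
coefficients. After pairing in v, the equation becomes a finite sum of constant coefficient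
derivatives of scalar functions. -/
theorem sum_transportCoeff_smul {d₁ d₂ : ℕ} (b : Euc d₂ → Euc d₁) (v : Euc d₂) :
    ∑ i, transportCoeff b v i • spaceTimeDir d₁ i = WithLp.toLp 2 (1, b v) := by
  rw [Fintype.sum_option]
  simp only [transportCoeff, spaceTimeDir, one_smul]
  have h1 : ∑ i, b v i • (WithLp.toLp 2 (0, EuclideanSpace.single i 1) : SpaceTime d₁)
      = WithLp.toLp 2 (0, b v) := by
    have h2 : ∑ i, b v i • (EuclideanSpace.single i 1 : Euc d₁) = b v := by
      simpa using (EuclideanSpace.basisFun (Fin d₁) ℝ).sum_repr (b v)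
    let L : Euc d₁ →ₗ[ℝ] SpaceTime d₁ :=
      (WithLp.linearEquiv 2 ℝ (ℝ × Euc d₁)).symm.toLinearMap.comp (LinearMap.inr ℝ ℝ (Euc d₁))
    have h3 : ∀ x, L x = WithLp.toLp 2 (0, x) := fun x => rfl
    simp only [← h3, ← map_smul]
    rw [← map_sum, h2]
  rw [h1, ← WithLp.toLp_add]
  simp

theorem sum_inner_spaceTimeDir {d₁ d₂ : ℕ} (b : Euc d₂ → Euc d₁) (v : Euc d₂) (ζ : SpaceTime d₁) :
    ∑ i, (inner ℝ ζ (spaceTimeDir d₁ i) : ℝ) * transportCoeff b v i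
      = ζ.fst + inner ℝ (b v) ζ.snd := by
  have : (inner ℝ ζ (WithLp.toLp 2 (1, b v) : SpaceTime d₁) : ℝ) = ζ.fst + inner ℝ (b v) ζ.snd := by
    rw [WithLp.prod_inner_apply, real_inner_comm (b v)]
    simp
  rw [← this, ← sum_transportCoeff_smul, inner_sum]
  exact Finset.sum_congr rfl fun i _ => by rw [inner_smul_right, mul_comm]

theorem fourier_sub_sum {E : Type*} [NormedAddCommGroup E] [InnerProductSpace ℝ E]
    [FiniteDimensional ℝ E] [MeasurableSpace E] [BorelSpace E] {ι : Type*} [Fintype ι]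
    (f : Lp ℂ 2 (volume : Measure E)) (g : ι → Lp ℂ 2 (volume : Measure E)) :
    (𝓕 (f - ∑ i, g i) : Lp ℂ 2 (volume : Measure E)) = 𝓕 f - ∑ i, 𝓕 (g i) := by
  have h := map_sub (Lp.fourierTransformₗᵢ E ℂ) f (∑ i, g i)
  rw [map_sum] at h
  exact h

theorem coeFn_sub_sum {E : Type*} [MeasurableSpace E] {ν : Measure E} {ι : Type*} [Fintype ι]
    (f : Lp ℂ 2 ν) (g : ι → Lp ℂ 2 ν) :
    (f - ∑ i, g i : Lp ℂ 2 ν) =ᵐ[ν] fun x => f x - ∑ i, g i x := by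
  classical
  have hs : ∀ s : Finset ι, (∑ i ∈ s, g i : Lp ℂ 2 ν) =ᵐ[ν] fun x => ∑ i ∈ s, g i x := by
    intro s
    induction s using Finset.induction_on with
    | empty => simp only [Finset.sum_empty]; exact Lp.coeFn_zero ℂ 2 ν
    | insert i s hi ih =>
      rw [Finset.sum_insert hi]
      filter_upwards [Lp.coeFn_add (g i) (∑ i ∈ s, g i), ih] with x h1 h2
      rw [h1, Pi.add_apply, h2, Finset.sum_insert hi]
  filter_upwards [Lp.coeFn_sub f (∑ i, g i), hs Finset.univ] with x h1 h2
  rw [h1, Pi.sub_apply, h2]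

/-- A first order weak equation between functionals of vector valued `L²` functions, on the Fourier
side. -/
theorem fourier_of_weak_eq_functional {E H : Type*} [NormedAddCommGroup E] [InnerProductSpace ℝ E]
    [FiniteDimensional ℝ E] [MeasurableSpace E] [BorelSpace E] [NormedAddCommGroup H]
    [InnerProductSpace ℂ H] [CompleteSpace H] {ι κ : Type*} [Fintype ι] [Fintype κ] (m : ι → E)
    (A : ι → H →L[ℂ] ℂ) (B : H →L[ℂ] ℂ) (D : κ → H →L[ℂ] ℂ)
    (u f : Lp H 2 (volume : Measure E)) (g : κ → Lp H 2 (volume : Measure E))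
    (hw : ∀ χ : E → ℝ, ContDiff ℝ ∞ χ → HasCompactSupport χ →
      ∑ i, ∫ x, ((fderiv ℝ χ x (m i) : ℝ) : ℂ) * A i (u x)
        = -((∫ x, (χ x : ℂ) * B (f x)) - ∑ j, ∫ x, (χ x : ℂ) * D j (g j x))) :
    ∀ᵐ ζ : E, ∑ i, 2 * Real.pi * Complex.I * (inner ℝ ζ (m i) : ℝ) *
        A i ((𝓕 u : Lp H 2 (volume : Measure E)) ζ) =
      B ((𝓕 f : Lp H 2 (volume : Measure E)) ζ) -
        ∑ j, D j ((𝓕 (g j) : Lp H 2 (volume : Measure E)) ζ) := by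
  have hweak := fourier_of_weak_eq m (fun i => (A i).compLp u)
    (B.compLp f - ∑ j, (D j).compLp (g j)) ?_
  · simp only [fourier_sub_sum, fourier_compLp] at hweak
    filter_upwards [hweak, coeFn_sub_sum (B.compLp (𝓕 f)) (fun j => (D j).compLp (𝓕 (g j))),
      B.coeFn_compLp (𝓕 f), ae_all_iff.2 fun j => (D j).coeFn_compLp (𝓕 (g j)),
      ae_all_iff.2 fun i => (A i).coeFn_compLp (𝓕 u)] with ζ h1 h2 h3 h4 h5
    rw [h2, h3] at h1
    simp only [h4, h5] at h1
    exact h1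
  · intro χ hχ hχc
    have hχC : Continuous fun z => (χ z : ℂ) := Complex.continuous_ofReal.comp hχ.continuous
    have hχCc : HasCompactSupport fun z => (χ z : ℂ) := hχc.comp_left (g := fun s : ℝ => (s : ℂ)) rfl
    have l1 : ∀ i, ∫ x, ((fderiv ℝ χ x (m i) : ℝ) : ℂ) * ((A i).compLp u) x
        = ∫ x, ((fderiv ℝ χ x (m i) : ℝ) : ℂ) * A i (u x) := fun i => by
      refine integral_congr_ae ?_
      filter_upwards [(A i).coeFn_compLp u] with z hz
      rw [hz]
    have l2 : ∫ x, (χ x : ℂ) * (B.compLp f) x = ∫ x, (χ x : ℂ) * B (f x) := by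
      refine integral_congr_ae ?_
      filter_upwards [B.coeFn_compLp f] with z hz
      rw [hz]
    have l3 : ∀ j, ∫ x, (χ x : ℂ) * ((D j).compLp (g j)) x = ∫ x, (χ x : ℂ) * D j (g j x) :=
      fun j => by
        refine integral_congr_ae ?_
        filter_upwards [(D j).coeFn_compLp (g j)] with z hz
        rw [hz]
    have l4 : ∫ z, (χ z : ℂ) * (B.compLp f - ∑ j, (D j).compLp (g j) : Lp ℂ 2 volume) z
        = (∫ z, (χ z : ℂ) * (B.compLp f) z) - ∑ j, ∫ z, (χ z : ℂ) * ((D j).compLp (g j)) z := by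
      rw [← integral_finsetSum _ fun j _ => integrable_mul_L2 hχC hχCc _,
        ← integral_sub (integrable_mul_L2 hχC hχCc _)
          (integrable_finsetSum _ fun j _ => integrable_mul_L2 hχC hχCc _)]
      refine integral_congr_ae ?_
      filter_upwards [coeFn_sub_sum (B.compLp f) fun j => (D j).compLp (g j)] with z hz
      rw [hz, mul_sub, Finset.mul_sum]
    rw [l4, l2]
    simp only [l1, l3]
    exact hw χ hχ hχc

section
variable {d₁ d₂ : ℕ} {R : ℝ} {b : Euc d₂ → Euc d₁}
    {h : ℝ × Euc d₁ × Euc d₂ → ℝ} {g₁ : ℝ × Euc d₁ × Euc d₂ → Euc d₂}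
    {g₀ : ℝ × Euc d₁ × Euc d₂ → ℝ}
    {μ : Measure (Euc d₂)} {Fh F0 : Lp (Lp ℂ 2 μ) 2 (volume : Measure (SpaceTime d₁))}
    {F1 : Fin d₂ → Lp (Lp ℂ 2 μ) 2 (volume : Measure (SpaceTime d₁))}

theorem memLp_transportCoeff_mul (hb : MemLp b 2 μ)
    [IsFiniteMeasure μ] {η : Euc d₂ → ℝ} (hη : Continuous η) (hηc : HasCompactSupport η) (i : Option (Fin d₁)) :
    MemLp (fun v => transportCoeff b v i * η v) 2 μ := by
  have hη2 : MemLp η 2 μ := hη.memLp_of_hasCompactSupport hηc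
  rcases i with _ | i
  · simpa [transportCoeff] using hη2
  · obtain ⟨C, hC⟩ := hηc.exists_bound_of_continuous hη
    have hbi : AEStronglyMeasurable (fun v => b v i) (μ) :=
      (EuclideanSpace.proj (𝕜 := ℝ) i).continuous.comp_aestronglyMeasurable hb.1
    refine hb.of_le_mul (c := C) (hbi.mul hη.aestronglyMeasurable) (Eventually.of_forall fun v => ?_)
    simp only [transportCoeff, norm_mul]
    rw [mul_comm]
    exact mul_le_mul (hC v) (PiLp.norm_apply_le _ _) (norm_nonneg _) ((norm_nonneg _).trans (hC v))

/-- The transport equation on the Fourier side, tested against a fixed function of velocity. -/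
theorem IsTransportSolution.fourier_identity (hμ : μ = volume.restrict (ball 0 R))
    (hsol : IsTransportSolution R b h g₁ g₀)
    (hb : MemLp b 2 μ)
    (hh : MemLp h 2 (volume.restrict (phaseDomain d₁ d₂ R)))
    (hg₁ : MemLp g₁ 2 (volume.restrict (phaseDomain d₁ d₂ R)))
    (hg₀ : MemLp g₀ 2 (volume.restrict (phaseDomain d₁ d₂ R)))
    (hFh : ∀ᵐ z, Fh z =ᵐ[μ] fun v => (h (phaseEquiv d₁ d₂ (z, v)) : ℂ))
    (hF0 : ∀ᵐ z, F0 z =ᵐ[μ] fun v => (g₀ (phaseEquiv d₁ d₂ (z, v)) : ℂ))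
    (hF1 : ∀ j, ∀ᵐ z, F1 j z =ᵐ[μ]
      fun v => (g₁ (phaseEquiv d₁ d₂ (z, v)) j : ℂ))
    {η : Euc d₂ → ℝ} (hη : ContDiff ℝ ∞ η) (hηc : HasCompactSupport η)
    (hηs : tsupport η ⊆ ball 0 R) :
    ∀ᵐ ζ : SpaceTime d₁, ∑ i, 2 * Real.pi * Complex.I * (inner ℝ ζ (spaceTimeDir d₁ i) : ℝ) *
        inner ℂ (realToL2 μ fun v => transportCoeff b v i * η v)
          ((𝓕 Fh : Lp _ 2 (volume : Measure (SpaceTime d₁))) ζ) =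
      inner ℂ (realToL2 μ η)
          ((𝓕 F0 : Lp _ 2 (volume : Measure (SpaceTime d₁))) ζ) -
        ∑ j, inner ℂ (realToL2 μ
          fun v => fderiv ℝ η v (EuclideanSpace.single j 1))
          ((𝓕 (F1 j) : Lp _ 2 (volume : Measure (SpaceTime d₁))) ζ) := by
  have hfin : IsFiniteMeasure μ :=
    ⟨by rw [hμ, Measure.restrict_apply_univ]; exact measure_ball_lt_top⟩
  have he := measurePreserving_phaseEquiv d₁ d₂ R
  rw [← hμ] at he
  have hh' : MemLp (fun p => h (phaseEquiv d₁ d₂ p)) 2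
      ((volume : Measure (SpaceTime d₁)).prod μ) := hh.comp_measurePreserving he
  have hg₀' : MemLp (fun p => g₀ (phaseEquiv d₁ d₂ p)) 2
      ((volume : Measure (SpaceTime d₁)).prod μ) := hg₀.comp_measurePreserving he
  have hg₁' : ∀ j, MemLp (fun p => g₁ (phaseEquiv d₁ d₂ p) j) 2
      ((volume : Measure (SpaceTime d₁)).prod μ) := fun j =>
    (hg₁.comp_measurePreserving he).of_le
      ((EuclideanSpace.proj (𝕜 := ℝ) j).continuous.comp_aestronglyMeasurable
        (hg₁.comp_measurePreserving he).1)
      (Eventually.of_forall fun p => PiLp.norm_apply_le _ _)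
  have ha := memLp_transportCoeff_mul hb hη.continuous hηc
  have hη2 : MemLp η 2 μ := hη.continuous.memLp_of_hasCompactSupport hηc
  have hdη : ∀ j : Fin d₂, MemLp (fun v => fderiv ℝ η v (EuclideanSpace.single j 1)) 2 μ := fun j =>
    ((hη.continuous_fderiv (by simp)).clm_apply continuous_const).memLp_of_hasCompactSupport
      ((hηc.fderiv (𝕜 := ℝ)).comp_left (g := fun L : Euc d₂ →L[ℝ] ℝ => L (EuclideanSpace.single j 1))
        rfl)
  refine fourier_of_weak_eq_functional (spaceTimeDir d₁)
    (fun i => innerSL ℂ (realToL2 μ fun v => transportCoeff b v i * η v))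
    (innerSL ℂ (realToL2 μ η))
    (fun j => innerSL ℂ (realToL2 μ fun v => fderiv ℝ η v (EuclideanSpace.single j 1)))
    Fh F0 F1 ?_
  · intro χ hχ hχc
    have hχ2 : MemLp χ 2 (volume : Measure (SpaceTime d₁)) :=
      hχ.continuous.memLp_of_hasCompactSupport hχc
    have hdχ : ∀ i, MemLp (fun z => fderiv ℝ χ z (spaceTimeDir d₁ i)) 2
        (volume : Measure (SpaceTime d₁)) := fun i =>
      ((hχ.continuous_fderiv (by simp)).clm_apply continuous_const).memLp_of_hasCompactSupport
        ((hχc.fderiv (𝕜 := ℝ)).comp_left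
          (g := fun L : SpaceTime d₁ →L[ℝ] ℝ => L (spaceTimeDir d₁ i)) rfl)
    have key := hsol.tensor hχ hχc hη hηc hηs
    rw [← hμ] at key
    have l1 : ∀ i, ∫ z, ((fderiv ℝ χ z (spaceTimeDir d₁ i) : ℝ) : ℂ) *
          inner ℂ (realToL2 μ fun v => transportCoeff b v i * η v) (Fh z)
        = ((∫ p, fderiv ℝ χ p.1 (spaceTimeDir d₁ i) * (transportCoeff b p.2 i * η p.2) *
          h (phaseEquiv d₁ d₂ p) ∂((volume : Measure (SpaceTime d₁)).prod μ) : ℝ) : ℂ) :=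
      fun i => integral_inner_curry hh' hFh (hdχ i) (ha i)
    have l2 : ∫ z, (χ z : ℂ) * inner ℂ (realToL2 μ η) (F0 z) = ((∫ p, χ p.1 * η p.2 *
          g₀ (phaseEquiv d₁ d₂ p) ∂((volume : Measure (SpaceTime d₁)).prod μ) : ℝ) : ℂ) :=
      integral_inner_curry hg₀' hF0 hχ2 hη2
    have l3 : ∀ j, ∫ z, (χ z : ℂ) *
          inner ℂ (realToL2 μ fun v => fderiv ℝ η v (EuclideanSpace.single j 1)) (F1 j z)
        = ((∫ p, χ p.1 * fderiv ℝ η p.2 (EuclideanSpace.single j 1) *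
          g₁ (phaseEquiv d₁ d₂ p) j ∂((volume : Measure (SpaceTime d₁)).prod μ) : ℝ) : ℂ) :=
      fun j => integral_inner_curry (hg₁' j) (hF1 j) hχ2 (hdη j)
    simp only [innerSL_apply_apply]
    rw [l2]
    simp only [l1, l3]
    have k1 : ∫ p, h (phaseEquiv d₁ d₂ p) * (fderiv ℝ χ p.1 (WithLp.toLp 2 (1, b p.2)) * η p.2)
          ∂((volume : Measure (SpaceTime d₁)).prod μ)
        = ∑ i, ∫ p, fderiv ℝ χ p.1 (spaceTimeDir d₁ i) * (transportCoeff b p.2 i * η p.2) *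
          h (phaseEquiv d₁ d₂ p) ∂((volume : Measure (SpaceTime d₁)).prod μ) := by
      rw [← integral_finsetSum _ fun i _ => integrable_tensor_mul (hdχ i) (ha i) hh']
      refine integral_congr_ae (Eventually.of_forall fun p => ?_)
      simp only
      rw [← sum_transportCoeff_smul, map_sum, Finset.sum_mul, Finset.mul_sum]
      refine Finset.sum_congr rfl fun i _ => ?_
      rw [map_smul, smul_eq_mul]; ring
    have k2 : ∫ p, χ p.1 * fderiv ℝ η p.2 (g₁ (phaseEquiv d₁ d₂ p))
          ∂((volume : Measure (SpaceTime d₁)).prod μ)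
        = ∑ j, ∫ p, χ p.1 * fderiv ℝ η p.2 (EuclideanSpace.single j 1) *
          g₁ (phaseEquiv d₁ d₂ p) j ∂((volume : Measure (SpaceTime d₁)).prod μ) := by
      rw [← integral_finsetSum _ fun j _ => integrable_tensor_mul hχ2 (hdη j) (hg₁' j)]
      refine integral_congr_ae (Eventually.of_forall fun p => ?_)
      simp only
      have h2 : g₁ (phaseEquiv d₁ d₂ p)
          = ∑ j, g₁ (phaseEquiv d₁ d₂ p) j • (EuclideanSpace.single j 1 : Euc d₂) := by
        simpa using ((EuclideanSpace.basisFun (Fin d₂) ℝ).sum_repr (g₁ (phaseEquiv d₁ d₂ p))).symm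
      conv_lhs => rw [h2]
      rw [map_sum, Finset.mul_sum]
      refine Finset.sum_congr rfl fun j _ => ?_
      rw [map_smul, smul_eq_mul]; ring
    have k3 : ∫ p, g₀ (phaseEquiv d₁ d₂ p) * (χ p.1 * η p.2)
          ∂((volume : Measure (SpaceTime d₁)).prod μ)
        = ∫ p, χ p.1 * η p.2 * g₀ (phaseEquiv d₁ d₂ p)
          ∂((volume : Measure (SpaceTime d₁)).prod μ) := by
      simp only [mul_comm]
    rw [k1, k2, k3] at key
    rw [← Complex.ofReal_sum, ← Complex.ofReal_sum, ← Complex.ofReal_sub, ← Complex.ofReal_neg]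
    congr 1
    linarith

/-- The transport equation on the Fourier side, as an estimate uniform over all test functions of
velocity. -/
theorem IsTransportSolution.fourier_bound (hμ : μ = volume.restrict (ball 0 R))
    (hsol : IsTransportSolution R b h g₁ g₀) (hb : MemLp b 2 μ)
    (hh : MemLp h 2 (volume.restrict (phaseDomain d₁ d₂ R)))
    (hg₁ : MemLp g₁ 2 (volume.restrict (phaseDomain d₁ d₂ R)))
    (hg₀ : MemLp g₀ 2 (volume.restrict (phaseDomain d₁ d₂ R)))
    (hFh : ∀ᵐ z, Fh z =ᵐ[μ] fun v => (h (phaseEquiv d₁ d₂ (z, v)) : ℂ))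
    (hF0 : ∀ᵐ z, F0 z =ᵐ[μ] fun v => (g₀ (phaseEquiv d₁ d₂ (z, v)) : ℂ))
    (hF1 : ∀ j, ∀ᵐ z, F1 j z =ᵐ[μ] fun v => (g₁ (phaseEquiv d₁ d₂ (z, v)) j : ℂ)) :
    ∀ᵐ ζ : SpaceTime d₁, ∀ η : Euc d₂ → ℝ, ContDiff ℝ ∞ η → HasCompactSupport η →
      tsupport η ⊆ ball 0 R →
      2 * Real.pi * ‖∫ v, (((ζ.fst + inner ℝ (b v) ζ.snd) * η v : ℝ) : ℂ) *
          ((𝓕 Fh : Lp (Lp ℂ 2 μ) 2 (volume : Measure (SpaceTime d₁))) ζ) v ∂μ‖ ≤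
        (eLpNorm η 2 μ).toReal *
          ‖(𝓕 F0 : Lp (Lp ℂ 2 μ) 2 (volume : Measure (SpaceTime d₁))) ζ‖ +
        ∑ j, (eLpNorm (fderiv ℝ η) 2 μ).toReal *
          ‖(𝓕 (F1 j) : Lp (Lp ℂ 2 μ) 2 (volume : Measure (SpaceTime d₁))) ζ‖ := by
  have hfin : IsFiniteMeasure μ :=
    ⟨by rw [hμ, Measure.restrict_apply_univ]; exact measure_ball_lt_top⟩
  have hsc : SecondCountableTopology (Lp ℂ 2 μ) := secondCountable_L2
  -- The test function will be chosen after ζ, so one null set must serve every η. The identity sees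
  -- η only through finitely many L² classes, namely η times the transport coefficients, η itself
  -- and its partial derivatives, and it is closed in them.
  have hall := ae_forall_of_forall_ae_isClosed (μ := (volume : Measure (SpaceTime d₁)))
    (ι := {η : Euc d₂ → ℝ // ContDiff ℝ ∞ η ∧ HasCompactSupport η ∧ tsupport η ⊆ ball 0 R})
    (X := (Option (Fin d₁) → Lp ℂ 2 μ) × Lp ℂ 2 μ × (Fin d₂ → Lp ℂ 2 μ))
    (fun η => (fun i => realToL2 μ fun v => transportCoeff b v i * η.1 v, realToL2 μ η.1,
      fun j => realToL2 μ fun v => fderiv ℝ η.1 v (EuclideanSpace.single j 1)))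
    (fun ζ x => ∑ i, 2 * Real.pi * Complex.I * (inner ℝ ζ (spaceTimeDir d₁ i) : ℝ) *
        inner ℂ (x.1 i) ((𝓕 Fh : Lp (Lp ℂ 2 μ) 2 (volume : Measure (SpaceTime d₁))) ζ) =
      inner ℂ x.2.1 ((𝓕 F0 : Lp (Lp ℂ 2 μ) 2 (volume : Measure (SpaceTime d₁))) ζ) -
        ∑ j, inner ℂ (x.2.2 j)
          ((𝓕 (F1 j) : Lp (Lp ℂ 2 μ) 2 (volume : Measure (SpaceTime d₁))) ζ))
    (fun ζ => isClosed_eq (by fun_prop) (by fun_prop))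
    (fun η => hsol.fourier_identity hμ hb hh hg₁ hg₀ hFh hF0 hF1 η.2.1 η.2.2.1 η.2.2.2)
  filter_upwards [hall] with ζ hζ η hη hηc hηs
  have key := hζ ⟨η, hη, hηc, hηs⟩
  simp only at key
  have ha := memLp_transportCoeff_mul hb hη.continuous hηc
  have hη2 : MemLp η 2 μ := hη.continuous.memLp_of_hasCompactSupport hηc
  have hdη2 : MemLp (fderiv ℝ η) 2 μ :=
    (hη.continuous_fderiv (by simp)).memLp_of_hasCompactSupport (hηc.fderiv (𝕜 := ℝ))
  have hdη : ∀ j : Fin d₂, MemLp (fun v => fderiv ℝ η v (EuclideanSpace.single j 1)) 2 μ := fun j =>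
    ((hη.continuous_fderiv (by simp)).clm_apply continuous_const).memLp_of_hasCompactSupport
      ((hηc.fderiv (𝕜 := ℝ)).comp_left (g := fun L : Euc d₂ →L[ℝ] ℝ => L (EuclideanSpace.single j 1))
        rfl)
  have hlhs : ∑ i, 2 * Real.pi * Complex.I * (inner ℝ ζ (spaceTimeDir d₁ i) : ℝ) *
        inner ℂ (realToL2 μ fun v => transportCoeff b v i * η v)
          ((𝓕 Fh : Lp (Lp ℂ 2 μ) 2 (volume : Measure (SpaceTime d₁))) ζ)
      = 2 * Real.pi * Complex.I * ∫ v, (((ζ.fst + inner ℝ (b v) ζ.snd) * η v : ℝ) : ℂ) *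
          ((𝓕 Fh : Lp (Lp ℂ 2 μ) 2 (volume : Measure (SpaceTime d₁))) ζ) v ∂μ := by
    simp only [inner_realToL2 (ha _), mul_assoc, ← integral_const_mul]
    rw [← integral_finsetSum]
    · refine integral_congr_ae (Eventually.of_forall fun v => ?_)
      simp only [← sum_inner_spaceTimeDir, Finset.sum_mul, Complex.ofReal_sum, Complex.ofReal_mul,
        Finset.mul_sum]
      refine Finset.sum_congr rfl fun i _ => ?_
      ring
    · intro i _
      exact ((((integrable_ofReal_mul_L2 (ha i) _).const_mul _).const_mul _).const_mul _).const_mul _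
  rw [hlhs] at key
  have hn := congrArg norm key
  rw [norm_mul, norm_mul, Complex.norm_I, mul_one, norm_mul, Complex.norm_real, Complex.norm_ofNat,
    Real.norm_of_nonneg Real.pi_pos.le] at hn
  rw [hn]
  refine (norm_sub_le _ _).trans (add_le_add ?_ ((norm_sum_le _ _).trans
    (Finset.sum_le_sum fun j _ => ?_)))
  · rw [← norm_realToL2 hη2]
    exact norm_inner_le_norm _ _
  · refine (norm_inner_le_norm _ _).trans (mul_le_mul_of_nonneg_right ?_ (norm_nonneg _))
    rw [norm_realToL2 (hdη j)]
    refine ENNReal.toReal_mono hdη2.2.ne (eLpNorm_mono fun v => ?_)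
    refine (ContinuousLinearMap.le_opNorm _ _).trans ?_
    simp

end

end

/-! ### The estimate at a fixed frequency and the choice of ε -/

section

open scoped Topology FourierTransform
open Filter

/-- The duality estimate of a velocity average at a fixed frequency `(τ, ξ)` of size `N`. -/
theorem norm_integral_average_le {d₁ d₂ : ℕ} {R K α M : ℝ} {b : Euc d₂ → Euc d₁}
    {Db : Euc d₂ → Euc d₂ →L[ℝ] Euc d₁} {μ : Measure (Euc d₂)}
    (hμ : μ = volume.restrict (ball 0 R)) (hK : 0 ≤ K) (hα : 0 < α) (hα1 : α ≤ 1) (hM : 0 ≤ M)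
    (hH : HasH1Deriv (ball 0 R) b Db) (hbM : ∀ᵐ v ∂μ, ‖b v‖ ≤ M) (hnd : IsNondegenerate R K α b)
    {ψ : Euc d₂ → ℝ} (hψ : ContDiff ℝ 1 ψ) (hψc : HasCompactSupport ψ)
    (hψs : tsupport ψ ⊆ ball 0 R) {P : ℝ} (hP : ∀ v, |ψ v| ≤ P) (hP' : ∀ v, ‖fderiv ℝ ψ v‖ ≤ P)
    (u : Lp ℂ 2 μ) {G₀ G₁ : ℝ} (hG₀ : 0 ≤ G₀) (hG₁ : 0 ≤ G₁) (τ : ℝ) (ξ : Euc d₁)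
    (hu : ∀ η : Euc d₂ → ℝ, ContDiff ℝ ∞ η → HasCompactSupport η → tsupport η ⊆ ball 0 R →
      2 * Real.pi * ‖∫ v, (((τ + inner ℝ (b v) ξ) * η v : ℝ) : ℂ) * u v ∂μ‖ ≤
        (eLpNorm η 2 μ).toReal * G₀ + (eLpNorm (fderiv ℝ η) 2 μ).toReal * G₁)
    {N : ℝ} (hN : 0 < N) (hN2 : N ^ 2 = τ ^ 2 + ‖ξ‖ ^ 2) {ε : ℝ} (hε : 0 < ε) (hε1 : ε ≤ 1) :
    ‖∫ v, (ψ v : ℂ) * u v ∂μ‖ ≤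
      P * (√(μ.real univ) + (eLpNorm Db 2 μ).toReal) * (ε ^ 2 * N)⁻¹ * (G₀ + G₁) +
      P * √(32 * (4 * (1 + M) * K + 2 * μ.real univ) * ε ^ α) * ‖u‖ := by
  have hfin : IsFiniteMeasure μ :=
    ⟨by rw [hμ, Measure.restrict_apply_univ]; exact measure_ball_lt_top⟩
  have hP0 : 0 ≤ P := (abs_nonneg _).trans (hP 0)
  set δ := ε * N with hδ
  have hδ0 : 0 < δ := by positivity
  obtain ⟨η, hη, hηc, hηs, hηP, hηl, hηd⟩ := hH.exists_test_sequence hψ hψc hψs hP hP' τ ξ hδ0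
  rw [← hμ] at hηl
  simp only [← hμ] at hηd
  have hbm : AEStronglyMeasurable b μ := by rw [hμ]; exact hH.memLp.1
  have hDfin : eLpNorm Db 2 μ ≠ ⊤ := by rw [hμ]; exact hH.memLp_deriv.2.ne
  set A : Euc d₂ → ℝ := fun v => τ + inner ℝ (b v) ξ with hA
  have hAm : AEStronglyMeasurable A μ :=
    aestronglyMeasurable_const.add (hbm.inner aestronglyMeasurable_const)
  have hψ2 : MemLp ψ 2 μ := hψ.continuous.memLp_of_hasCompactSupport hψc
  have hsqrt : (μ univ ^ (1 / 2 : ℝ)).toReal = √(μ.real univ) := by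
    rw [← ENNReal.toReal_rpow, Real.sqrt_eq_rpow]; rfl
  have hξN : ‖ξ‖ ≤ N := by
    refine abs_le_of_sq_le_sq' ?_ hN.le |>.2
    rw [hN2]; nlinarith [sq_nonneg τ]
  -- With ε ≤ 1 and |ξ| ≤ N, the bounds 1/δ and |ξ|/δ² are both dominated by (ε²N)⁻¹.
  have hinv : 1 / δ ≤ (ε ^ 2 * N)⁻¹ := by
    rw [one_div]; gcongr
    rw [hδ]; gcongr
    nlinarith
  have hinv2 : 1 / δ ^ 2 * ‖ξ‖ ≤ (ε ^ 2 * N)⁻¹ := by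
    calc 1 / δ ^ 2 * ‖ξ‖ ≤ 1 / δ ^ 2 * N := by gcongr
      _ = _ := by rw [hδ]; field_simp
  have hb0 : ∀ n, (eLpNorm (η n) 2 μ).toReal ≤ P * √(μ.real univ) * (ε ^ 2 * N)⁻¹ := by
    intro n
    have h1 : eLpNorm (η n) 2 μ ≤ μ univ ^ (1 / 2 : ℝ) * ENNReal.ofReal (P * (1 / δ)) := by
      refine (eLpNorm_le_of_ae_bound (C := P * (1 / δ)) (Eventually.of_forall fun v => ?_)).trans ?_
      · exact hηP n v
      · norm_num
    refine (ENNReal.toReal_mono (ENNReal.mul_ne_top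
      (ENNReal.rpow_ne_top_of_nonneg (by norm_num) (measure_ne_top _ _)) ENNReal.ofReal_ne_top)
      h1).trans ?_
    rw [ENNReal.toReal_mul, hsqrt, ENNReal.toReal_ofReal (by positivity)]
    calc √(μ.real univ) * (P * (1 / δ)) ≤ √(μ.real univ) * (P * (ε ^ 2 * N)⁻¹) := by gcongr
      _ = _ := by ring
  have hb1 : ∀ n, (eLpNorm (fderiv ℝ (η n)) 2 μ).toReal ≤
      P * (√(μ.real univ) + (eLpNorm Db 2 μ).toReal) * (ε ^ 2 * N)⁻¹ := by
    intro n
    refine (ENNReal.toReal_mono (ENNReal.add_ne_top.2 ⟨ENNReal.mul_ne_top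
      (ENNReal.rpow_ne_top_of_nonneg (by norm_num) (measure_ne_top _ _)) ENNReal.ofReal_ne_top,
      ENNReal.mul_ne_top ENNReal.ofReal_ne_top hDfin⟩) (hηd n)).trans ?_
    rw [ENNReal.toReal_add (ENNReal.mul_ne_top
      (ENNReal.rpow_ne_top_of_nonneg (by norm_num) (measure_ne_top _ _)) ENNReal.ofReal_ne_top)
      (ENNReal.mul_ne_top ENNReal.ofReal_ne_top hDfin), ENNReal.toReal_mul, ENNReal.toReal_mul,
      hsqrt, ENNReal.toReal_ofReal (by positivity), ENNReal.toReal_ofReal (by positivity)]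
    calc √(μ.real univ) * (P * (1 / δ)) + P * (1 / δ ^ 2) * ‖ξ‖ * (eLpNorm Db 2 μ).toReal
        = √(μ.real univ) * (P * (1 / δ)) + P * (1 / δ ^ 2 * ‖ξ‖) * (eLpNorm Db 2 μ).toReal := by ring
      _ ≤ √(μ.real univ) * (P * (ε ^ 2 * N)⁻¹) + P * (ε ^ 2 * N)⁻¹ * (eLpNorm Db 2 μ).toReal := by
          gcongr
      _ = _ := by ring
  set B := P * (√(μ.real univ) + (eLpNorm Db 2 μ).toReal) * (ε ^ 2 * N)⁻¹ with hB
  have hAη : ∀ n, ‖∫ v, ((A v * η n v : ℝ) : ℂ) * u v ∂μ‖ ≤ B * (G₀ + G₁) := by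
    intro n
    have h1 := hu (η n) (hη n) (hηc n) (hηs n)
    have h2 : (eLpNorm (η n) 2 μ).toReal ≤ B := (hb0 n).trans (by
      rw [hB]; gcongr; exact le_add_of_nonneg_right ENNReal.toReal_nonneg)
    have h3 : 1 ≤ 2 * Real.pi := by linarith [Real.pi_gt_three]
    calc _ ≤ 2 * Real.pi * ‖∫ v, ((A v * η n v : ℝ) : ℂ) * u v ∂μ‖ :=
          le_mul_of_one_le_left (norm_nonneg _) h3
      _ ≤ _ := h1
      _ ≤ B * G₀ + B * G₁ := by gcongr; exact hb1 n
      _ = _ := by ring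
  -- Only the pairing passes to the limit, so weak differentiability of the limiting test function
  -- is never needed. The bound on b supplies the domination, and u is integrable because the ball
  -- has finite measure.
  have hlim : Tendsto (fun n => ∫ v, ((A v * η n v : ℝ) : ℂ) * u v ∂μ) atTop
      (𝓝 (∫ v, ((A v * (ψ v * (A v / (A v ^ 2 + δ ^ 2))) : ℝ) : ℂ) * u v ∂μ)) := by
    refine tendsto_integral_of_dominated_convergence
      (fun v => (|τ| + M * ‖ξ‖) * (P * (1 / δ)) * ‖u v‖) (fun n => ?_) ?_ (fun n => ?_) ?_
    · exact (Complex.continuous_ofReal.comp_aestronglyMeasurable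
        (hAm.mul (hη n).continuous.aestronglyMeasurable)).mul (Lp.aestronglyMeasurable u)
    · exact ((Lp.memLp u).integrable (by norm_num)).norm.const_mul _
    · filter_upwards [hbM] with v hv
      rw [norm_mul, Complex.norm_real, norm_mul]
      gcongr
      · refine (norm_add_le _ _).trans (add_le_add le_rfl ?_)
        exact (norm_inner_le_norm _ _).trans (by gcongr)
      · exact hηP n v
    · filter_upwards [hηl] with v hv
      exact ((Complex.continuous_ofReal.tendsto _).comp (hv.const_mul (A v))).mul_const _
  have h1 := le_of_tendsto hlim.norm (Eventually.of_forall hAη)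
  set w : Euc d₂ → ℝ := fun v => δ ^ 2 / (A v ^ 2 + δ ^ 2) with hw
  have hwc : Continuous fun a : ℝ => δ ^ 2 / (a ^ 2 + δ ^ 2) :=
    continuous_const.div (by fun_prop) fun a => by positivity
  have hwm : AEStronglyMeasurable w μ := hwc.comp_aestronglyMeasurable hAm
  have hW : eLpNorm w 2 μ ≤
      ENNReal.ofReal √(32 * (4 * (1 + M) * K + 2 * μ.real univ) * ε ^ α) := by
    have h2 : ∀ s : ℝ, 0 < s → μ {v | |A v| ≤ s * N} ≤
        ENNReal.ofReal ((4 * (1 + M) * K + 2 * μ.real univ) * s ^ α) := by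
      intro s hs
      have h3 := hnd.measure_symbol_le hK hα hα1 hM (by rw [← hμ]; exact hbM) τ ξ hN hN2 hs
      rw [← hμ] at h3
      rwa [show μ.real univ = volume.real (ball (0 : Euc d₂) R) by
        rw [hμ, measureReal_restrict_apply_univ]]
    have h4 := lintegral_regularized_le hAm.aemeasurable (by positivity) hN hα1 hε h2
    rw [← hδ, ← eLpNorm_two_sq (f := w)] at h4
    rw [← ENNReal.pow_le_pow_left_iff (n := 2) (by norm_num),
      ← ENNReal.ofReal_pow (Real.sqrt_nonneg _), Real.sq_sqrt (by positivity)]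
    exact h4
  have hψw : eLpNorm (fun v => ψ v * w v) 2 μ ≤ ENNReal.ofReal P * eLpNorm w 2 μ := by
    refine eLpNorm_le_mul_eLpNorm_of_ae_le_mul (Eventually.of_forall fun v => ?_) 2
    rw [norm_mul]
    gcongr
    exact hP v
  have hψwL : MemLp (fun v => ψ v * w v) 2 μ :=
    ⟨hψ.continuous.aestronglyMeasurable.mul hwm, hψw.trans_lt
      (ENNReal.mul_lt_top ENNReal.ofReal_lt_top (hW.trans_lt ENNReal.ofReal_lt_top))⟩
  have h2 : ‖∫ v, ((ψ v * w v : ℝ) : ℂ) * u v ∂μ‖ ≤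
      P * √(32 * (4 * (1 + M) * K + 2 * μ.real univ) * ε ^ α) * ‖u‖ := by
    rw [← inner_realToL2 hψwL]
    refine (norm_inner_le_norm _ _).trans (mul_le_mul_of_nonneg_right ?_ (norm_nonneg _))
    rw [norm_realToL2 hψwL]
    refine ENNReal.toReal_le_of_le_ofReal (by positivity) (hψw.trans ?_)
    rw [ENNReal.ofReal_mul hP0]
    gcongr
  -- This is A²/(A² + δ²) + δ²/(A² + δ²) = 1: the equation controls the first part and nondegeneracy
  -- the second.
  have hsplit : ∀ v, ψ v = A v * (ψ v * (A v / (A v ^ 2 + δ ^ 2))) + ψ v * w v := fun v => by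
    have : A v ^ 2 + δ ^ 2 ≠ 0 := by positivity
    simp only [hw]
    field_simp
  have hAψ : MemLp (fun v => A v * (ψ v * (A v / (A v ^ 2 + δ ^ 2)))) 2 μ := by
    refine (hψ2.sub hψwL).ae_eq (Eventually.of_forall fun v => ?_)
    simp only [Pi.sub_apply]
    linarith [hsplit v]
  have hsum : ∫ v, (ψ v : ℂ) * u v ∂μ
      = (∫ v, ((A v * (ψ v * (A v / (A v ^ 2 + δ ^ 2))) : ℝ) : ℂ) * u v ∂μ) +
        ∫ v, ((ψ v * w v : ℝ) : ℂ) * u v ∂μ := by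
    rw [← integral_add (integrable_ofReal_mul_L2 hAψ u) (integrable_ofReal_mul_L2 hψwL u)]
    refine integral_congr_ae (Eventually.of_forall fun v => ?_)
    simp only
    rw [← add_mul, ← Complex.ofReal_add, ← hsplit v]
  rw [hsum]
  exact (norm_add_le _ _).trans (add_le_add h1 h2)

/-- The gain of `α / (4 + α)` derivatives, from the optimal choice of the regularization. -/
theorem sobolev_weight_mul_le {α : ℝ} (hα : 0 < α) {x N P a c G H : ℝ}
    (hN : 0 ≤ N) (hP : 0 ≤ P) (ha : 0 ≤ a) (hc : 0 ≤ c) (hG : 0 ≤ G) (hH : 0 ≤ H)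
    (hlow : x ≤ P * a * H)
    (hhigh : 0 < N → ∀ ε : ℝ, 0 < ε → ε ≤ 1 →
      x ≤ P * a * (ε ^ 2 * N)⁻¹ * G + P * √(c * ε ^ α) * H) :
    (1 + N ^ 2) ^ (α / (4 + α) / 2) * x ≤ 2 * (a + √c) * P * (H + G) := by
  set s := α / (4 + α) with hs
  have hs0 : 0 < s := by positivity
  have hs1 : s ≤ 1 := by rw [hs, div_le_one (by positivity)]; linarith
  have h2 : (2 : ℝ) ^ (s / 2) ≤ 2 := by
    calc (2 : ℝ) ^ (s / 2) ≤ 2 ^ (1 : ℝ) :=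
          Real.rpow_le_rpow_of_exponent_le one_le_two (by linarith)
      _ = 2 := Real.rpow_one 2
  have hRHS : 0 ≤ P * (a + √c) * (H + G) := by positivity
  rcases le_or_gt N 1 with hN1 | hN1
  -- At low frequency the weight is bounded, so the trivial estimate is enough.
  · have h3 : (1 + N ^ 2) ^ (s / 2) ≤ 2 :=
      (Real.rpow_le_rpow (by positivity) (by nlinarith) (by positivity)).trans h2
    have h4 : x ≤ P * (a + √c) * (H + G) := by
      refine hlow.trans ?_
      gcongr
      · exact le_add_of_nonneg_right (Real.sqrt_nonneg _)
      · exact le_add_of_nonneg_right hG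
    calc (1 + N ^ 2) ^ (s / 2) * x ≤ (1 + N ^ 2) ^ (s / 2) * (P * (a + √c) * (H + G)) := by gcongr
      _ ≤ 2 * (P * (a + √c) * (H + G)) := by gcongr
      _ = _ := by ring
  · have hN0 : 0 < N := by linarith
    -- This solves (ε²N)⁻¹ = ε^(α/2), and the common value is N^(-s). It satisfies ε ≤ 1 because N >
    -- 1.
    set ε := N ^ (-2 / (4 + α)) with hε
    have hε0 : 0 < ε := by positivity
    have hε1 : ε ≤ 1 := Real.rpow_le_one_of_one_le_of_nonpos hN1.le
      (div_nonpos_of_nonpos_of_nonneg (by norm_num) (by positivity))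
    have e1 : (ε ^ 2 * N)⁻¹ = N ^ (-s) := by
      rw [hε, ← Real.rpow_natCast, ← Real.rpow_mul hN, ← Real.rpow_add_one hN0.ne',
        ← Real.rpow_neg hN]
      congr 1
      rw [hs]; push_cast; field_simp; ring
    have e2 : √(c * ε ^ α) = √c * N ^ (-s) := by
      rw [Real.sqrt_mul hc, hε, ← Real.rpow_mul hN, Real.sqrt_eq_rpow (N ^ _), ← Real.rpow_mul hN]
      congr 2
      rw [hs]; field_simp
    have h5 := hhigh hN0 ε hε0 hε1
    rw [e1, e2] at h5
    have hNs : 0 ≤ N ^ (-s) := by positivity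
    have h6 : x ≤ N ^ (-s) * (P * (a + √c) * (H + G)) := by
      refine h5.trans ?_
      have : 0 ≤ N ^ (-s) * P * (a * H + √c * G) := by positivity
      nlinarith
    have h7 : (1 + N ^ 2) ^ (s / 2) ≤ 2 * N ^ s := by
      calc (1 + N ^ 2) ^ (s / 2) ≤ (2 * N ^ 2) ^ (s / 2) :=
            Real.rpow_le_rpow (by positivity) (by nlinarith) (by positivity)
        _ = 2 ^ (s / 2) * N ^ s := by
            rw [Real.mul_rpow (by norm_num) (by positivity), ← Real.rpow_natCast N 2,
              ← Real.rpow_mul hN]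
            congr 2
            push_cast; ring
        _ ≤ _ := by gcongr
    calc (1 + N ^ 2) ^ (s / 2) * x
        ≤ (1 + N ^ 2) ^ (s / 2) * (N ^ (-s) * (P * (a + √c) * (H + G))) := by gcongr
      _ ≤ 2 * N ^ s * (N ^ (-s) * (P * (a + √c) * (H + G))) := by gcongr
      _ = 2 * (N ^ s * N ^ (-s)) * (P * (a + √c) * (H + G)) := by ring
      _ = _ := by rw [← Real.rpow_add hN0]; simp; ring

end

/-! ### Sobolev norms and the conclusion -/

open scoped Topology FourierTransform
open Filter

/-- By continuity, the part of U where f exceeds its essential supremum is open; being null, it is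
empty. -/
theorem enorm_le_eLpNorm_top_restrict {X F : Type*} [TopologicalSpace X] [MeasurableSpace X]
    [OpensMeasurableSpace X] {ν : Measure X} [ν.IsOpenPosMeasure] [NormedAddCommGroup F]
    {f : X → F} (hf : Continuous f) {U : Set X} (hU : IsOpen U) {x : X} (hx : x ∈ U) :
    ‖f x‖ₑ ≤ eLpNorm f ⊤ (ν.restrict U) := by
  by_contra! hlt
  set c := eLpNorm f ⊤ (ν.restrict U)
  have hae : ∀ᵐ y ∂ν.restrict U, ‖f y‖ₑ ≤ c := by
    simpa [c, eLpNorm_exponent_top] using ae_le_eLpNormEssSup (f := f) (μ := ν.restrict U)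
  have hopen : IsOpen ({y | c < ‖f y‖ₑ} ∩ U) :=
    (isOpen_lt continuous_const hf.enorm).inter hU
  have hzero : ν ({y | c < ‖f y‖ₑ} ∩ U) = 0 := by
    have h1 := ae_iff.1 hae
    simp only [not_le] at h1
    rwa [Measure.restrict_apply (isOpen_lt continuous_const hf.enorm).measurableSet] at h1
  have hempty := (hopen.measure_eq_zero_iff ν).1 hzero
  exact (hempty ▸ (⟨hlt, hx⟩ : x ∈ {y | c < ‖f y‖ₑ} ∩ U) : x ∈ (∅ : Set X))

/-- The `W^{1,∞}` norm of a compactly supported `C¹` function is finite and bounds the function and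
its derivative everywhere. -/
theorem w1InftyNorm_spec {d₂ : ℕ} {R : ℝ} {ψ : Euc d₂ → ℝ} (hψ : ContDiff ℝ 1 ψ)
    (hψc : HasCompactSupport ψ) (hψs : tsupport ψ ⊆ ball 0 R) :
    w1InftyNorm R ψ ≠ ⊤ ∧ (∀ v, |ψ v| ≤ (w1InftyNorm R ψ).toReal) ∧
      ∀ v, ‖fderiv ℝ ψ v‖ ≤ (w1InftyNorm R ψ).toReal := by
  have hd : Continuous (fderiv ℝ ψ) := hψ.continuous_fderiv (by simp)
  have hfin : w1InftyNorm R ψ ≠ ⊤ := ENNReal.add_ne_top.2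
    ⟨((hψ.continuous.memLp_of_hasCompactSupport hψc).2).ne,
      ((hd.memLp_of_hasCompactSupport (hψc.fderiv (𝕜 := ℝ))).2).ne⟩
  refine ⟨hfin, fun v => ?_, fun v => ?_⟩
  · by_cases hv : v ∈ ball (0 : Euc d₂) R
    · have h1 := (enorm_le_eLpNorm_top_restrict (ν := volume) hψ.continuous isOpen_ball hv).trans
        (le_add_right le_rfl : _ ≤ w1InftyNorm R ψ)
      simpa using ENNReal.toReal_mono hfin h1
    · rw [image_eq_zero_of_notMem_tsupport fun h => hv (hψs h)]
      simp
  · by_cases hv : v ∈ ball (0 : Euc d₂) R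
    · have h1 := (enorm_le_eLpNorm_top_restrict (ν := volume) hd isOpen_ball hv).trans
        (le_add_left le_rfl : _ ≤ w1InftyNorm R ψ)
      simpa using ENNReal.toReal_mono hfin h1
    · rw [image_eq_zero_of_notMem_tsupport fun h => hv (hψs (tsupport_fderiv_subset ℝ h))]
      simp

/-- A bound of the weighted Fourier transform gives membership in a Sobolev space and a bound of
the Sobolev norm. -/
theorem sobolevNorm_le_of_fourier {E : Type*} [NormedAddCommGroup E] [InnerProductSpace ℝ E]
    [FiniteDimensional ℝ E] [MeasurableSpace E] [BorelSpace E] (s : ℝ)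
    (u : Lp ℂ 2 (volume : Measure E))
    (hW : MemLp (fun ζ : E => (((1 + ‖ζ‖ ^ 2) ^ (s / 2) : ℝ) : ℂ) *
      (𝓕 u : Lp ℂ 2 (volume : Measure E)) ζ) 2 volume) :
    TemperedDistribution.MemSobolev s 2 (u : 𝓢'(E, ℂ)) ∧
      sobolevNorm s (u : 𝓢'(E, ℂ)) ≤ eLpNorm (fun ζ : E => (((1 + ‖ζ‖ ^ 2) ^ (s / 2) : ℝ) : ℂ) *
        (𝓕 u : Lp ℂ 2 (volume : Measure E)) ζ) 2 volume := by
  -- The inverse transform of the weighted Fourier transform represents the Bessel potential, and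
  -- Plancherel gives its norm.
  set w : Lp ℂ 2 (volume : Measure E) := 𝓕⁻ (hW.toLp _) with hw
  have hg : (fun x : E => (((1 + ‖x‖ ^ 2) ^ (s / 2) : ℝ) : ℂ)).HasTemperateGrowth := by fun_prop
  have key : TemperedDistribution.besselPotential E ℂ s (u : 𝓢'(E, ℂ)) = (w : 𝓢'(E, ℂ)) := by
    rw [TemperedDistribution.besselPotential, TemperedDistribution.fourierMultiplierCLM_apply, hw,
      ← Lp.fourierInv_toTemperedDistribution_eq, Lp.fourier_toTemperedDistribution_eq]
    congr 1
    ext κ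
    rw [TemperedDistribution.smulLeftCLM_apply_apply, Lp.toTemperedDistribution_apply,
      Lp.toTemperedDistribution_apply]
    refine integral_congr_ae ?_
    filter_upwards [hW.coeFn_toLp] with x hx
    rw [hx, SchwartzMap.smulLeftCLM_apply_apply hg]
    simp only [smul_eq_mul]
    ring
  refine ⟨⟨w, key⟩, (iInf₂_le w key).trans (le_of_eq ?_)⟩
  have h1 : ‖w‖ = ‖hW.toLp _‖ := (Lp.fourierTransformₗᵢ E ℂ).symm.norm_map _
  rw [← ofReal_norm, h1, ofReal_norm, Lp.enorm_toLp]

theorem enorm_fourier_eq {E H : Type*} [NormedAddCommGroup E] [InnerProductSpace ℝ E]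
    [FiniteDimensional ℝ E] [MeasurableSpace E] [BorelSpace E] [NormedAddCommGroup H]
    [InnerProductSpace ℂ H] [CompleteSpace H] (u : Lp H 2 (volume : Measure E)) :
    eLpNorm (𝓕 u : Lp H 2 (volume : Measure E)) 2 volume = ‖u‖ₑ := by
  rw [← Lp.enorm_def, ← ofReal_norm, Lp.norm_fourier_eq, ofReal_norm]

/-- The velocity average of a curried function. -/
theorem velocityAverage_ae_eq {d₁ d₂ : ℕ} {R : ℝ} {μ : Measure (Euc d₂)}
    (hμ : μ = volume.restrict (ball 0 R)) {h : ℝ × Euc d₁ × Euc d₂ → ℝ} {ψ : Euc d₂ → ℝ}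
    (hψ : MemLp ψ 2 μ) {Fh : Lp (Lp ℂ 2 μ) 2 (volume : Measure (SpaceTime d₁))}
    (hFh : ∀ᵐ z, Fh z =ᵐ[μ] fun v => (h (phaseEquiv d₁ d₂ (z, v)) : ℂ)) :
    velocityAverage R h ψ =ᵐ[volume] (innerSL ℂ (realToL2 μ ψ)).compLp Fh := by
  filter_upwards [(innerSL ℂ (realToL2 μ ψ)).coeFn_compLp Fh, hFh] with z h1 h2
  rw [h1, innerSL_apply_apply, inner_realToL2 hψ, velocityAverage, ← hμ, ← integral_complex_ofReal]
  refine integral_congr_ae ?_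
  filter_upwards [h2] with v hv
  rw [hv, phaseEquiv_apply, Complex.ofReal_mul, mul_comm]

theorem exists_curried_phase_function {d₁ d₂ : ℕ} {R : ℝ} {μ : Measure (Euc d₂)}
    (hμ : μ = volume.restrict (ball 0 R)) {f : ℝ × Euc d₁ × Euc d₂ → ℝ}
    (hf : MemLp f 2 (volume.restrict (phaseDomain d₁ d₂ R))) :
    ∃ F : Lp (Lp ℂ 2 μ) 2 (volume : Measure (SpaceTime d₁)),
      (∀ᵐ z, F z =ᵐ[μ] fun v => (f (phaseEquiv d₁ d₂ (z, v)) : ℂ)) ∧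
      ‖F‖ₑ = eLpNorm f 2 (volume.restrict (phaseDomain d₁ d₂ R)) := by
  have hfin : IsFiniteMeasure μ :=
    ⟨by rw [hμ, Measure.restrict_apply_univ]; exact measure_ball_lt_top⟩
  have he := measurePreserving_phaseEquiv d₁ d₂ R
  rw [← hμ] at he
  obtain ⟨F, h1, h2⟩ := exists_Lp_curry (f := fun p => (f (phaseEquiv d₁ d₂ p) : ℂ))
    (ν := (volume : Measure (SpaceTime d₁))) (μ := μ) (hf.comp_measurePreserving he).ofReal
  refine ⟨F, h1, h2.trans ?_⟩
  rw [← eLpNorm_comp_measurePreserving hf.1 he]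
  exact eLpNorm_congr_norm_ae (Eventually.of_forall fun p => by simp)

theorem eLpNorm_add_add_sum_le {α H : Type*} [MeasurableSpace α] {ν : Measure α}
    [NormedAddCommGroup H] {ι : Type*} [Fintype ι] (u f : Lp H 2 ν) (g : ι → Lp H 2 ν) :
    eLpNorm (fun x => ‖u x‖ + (‖f x‖ + ∑ j, ‖g j x‖)) 2 ν ≤
      eLpNorm u 2 ν + (eLpNorm f 2 ν + ∑ j, eLpNorm (g j) 2 ν) := by
  have hm : ∀ k : Lp H 2 ν, AEStronglyMeasurable (fun x => ‖k x‖) ν := fun k =>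
    (Lp.aestronglyMeasurable k).norm
  have hs : AEStronglyMeasurable (fun x => ∑ j, ‖g j x‖) ν :=
    Finset.aestronglyMeasurable_fun_sum _ fun j _ => hm (g j)
  refine (eLpNorm_add_le (hm u) ((hm f).add hs) (by norm_num)).trans ?_
  rw [eLpNorm_norm]
  gcongr
  refine (eLpNorm_add_le (hm f) hs (by norm_num)).trans ?_
  rw [eLpNorm_norm]
  gcongr
  have h1 := eLpNorm_sum_le (p := 2) (s := Finset.univ) (f := fun j x => ‖g j x‖)
    (fun j _ => hm (g j)) (by norm_num)
  simp only [eLpNorm_norm] at h1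
  have h2 : (fun x => ∑ j, ‖g j x‖) = ∑ j, fun x => ‖g j x‖ := by
    funext x
    rw [Finset.sum_apply]
  rw [h2]
  exact h1

set_option maxHeartbeats 1000000 in
theorem lemma2p1 (d₁ d₂ : ℕ) (hd₁ : 0 < d₁) (hd₂ : 0 < d₂) (K R : ℝ) (hK : 0 < K) (hR : 0 < R)
    (Mb MDb : ℝ≥0) :
    ∃ C : ℝ≥0, 0 < C ∧
      ∀ (α : ℝ), 0 < α → α ≤ 1 →
      ∀ (b : Euc d₂ → Euc d₁) (Db : Euc d₂ → Euc d₂ →L[ℝ] Euc d₁),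
        MemLp b ∞ (volume.restrict (ball 0 R)) →
        HasH1Deriv (ball 0 R) b Db →
        eLpNorm b ∞ (volume.restrict (ball 0 R)) ≤ Mb →
        eLpNorm Db 2 (volume.restrict (ball 0 R)) ≤ MDb →
        IsNondegenerate R K α b →
      ∀ (ψ : Euc d₂ → ℝ), ContDiff ℝ 1 ψ → HasCompactSupport ψ → tsupport ψ ⊆ ball 0 R →
      ∀ (h : ℝ × Euc d₁ × Euc d₂ → ℝ) (g₁ : ℝ × Euc d₁ × Euc d₂ → Euc d₂)
        (g₀ : ℝ × Euc d₁ × Euc d₂ → ℝ),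
        MemLp h 2 (volume.restrict (phaseDomain d₁ d₂ R)) →
        MemLp g₁ 2 (volume.restrict (phaseDomain d₁ d₂ R)) →
        MemLp g₀ 2 (volume.restrict (phaseDomain d₁ d₂ R)) →
        IsTransportSolution R b h g₁ g₀ →
        ∃ hL : MemLp (velocityAverage R h ψ) 2 (volume : Measure (SpaceTime d₁)),
          TemperedDistribution.MemSobolev (α / (4 + α)) 2
            (hL.toLp (velocityAverage R h ψ) : 𝓢'(SpaceTime d₁, ℂ)) ∧
          sobolevNorm (α / (4 + α)) (hL.toLp (velocityAverage R h ψ) : 𝓢'(SpaceTime d₁, ℂ)) ≤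
            C * w1InftyNorm R ψ *
              (eLpNorm h 2 (volume.restrict (phaseDomain d₁ d₂ R)) +
                eLpNorm g₁ 2 (volume.restrict (phaseDomain d₁ d₂ R)) +
                eLpNorm g₀ 2 (volume.restrict (phaseDomain d₁ d₂ R))) := by
  obtain ⟨μ, hμ⟩ : ∃ μ : Measure (Euc d₂), μ = volume.restrict (ball 0 R) := ⟨_, rfl⟩
  have hfin : IsFiniteMeasure μ :=
    ⟨by rw [hμ, Measure.restrict_apply_univ]; exact measure_ball_lt_top⟩
  set a : ℝ := √(μ.real univ) + MDb with ha
  set c : ℝ := 32 * (4 * (1 + Mb) * K + 2 * μ.real univ) with hc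
  have ha0 : 0 ≤ a := by positivity
  have hc0 : 0 < c := by positivity
  set C₀ : ℝ := 2 * (a + √c) with hC₀
  have hC₀0 : 0 < C₀ := by positivity
  -- Here a collects the cost of the test function and c the sublevel set bound; neither involves α.
  -- The factor d₂ + 1 pays for estimating each component of g₁ by the whole vector.
  refine ⟨Real.toNNReal C₀ * (d₂ + 1), by positivity, ?_⟩
  intro α hα hα1 b Db _ hH hbM hDbM hnd ψ hψ hψc hψs h g₁ g₀ hh hg₁ hg₀ hsol
  obtain ⟨hPfin, hP, hP'⟩ := w1InftyNorm_spec hψ hψc hψs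
  set P := (w1InftyNorm R ψ).toReal with hPdef
  have hP0 : 0 ≤ P := ENNReal.toReal_nonneg
  have hψ2 : MemLp ψ 2 μ := hψ.continuous.memLp_of_hasCompactSupport hψc
  have hg₁' : ∀ j, MemLp (fun p => g₁ p j) 2 (volume.restrict (phaseDomain d₁ d₂ R)) := fun j =>
    hg₁.of_le ((EuclideanSpace.proj (𝕜 := ℝ) j).continuous.comp_aestronglyMeasurable hg₁.1)
      (Eventually.of_forall fun p => PiLp.norm_apply_le _ _)
  obtain ⟨Fh, hFh, hFhn⟩ := exists_curried_phase_function hμ hh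
  obtain ⟨F0, hF0, hF0n⟩ := exists_curried_phase_function hμ hg₀
  choose F1 hF1 hF1n using fun j => exists_curried_phase_function hμ (hg₁' j)
  have hF1n' : ∀ j, ‖F1 j‖ₑ ≤ eLpNorm g₁ 2 (volume.restrict (phaseDomain d₁ d₂ R)) := fun j => by
    rw [hF1n j]
    exact eLpNorm_mono fun p => PiLp.norm_apply_le _ _
  have hb2 : MemLp b 2 μ := by rw [hμ]; exact hH.memLp
  have hbM' : ∀ᵐ v ∂μ, ‖b v‖ ≤ Mb := by
    rw [← hμ, eLpNorm_exponent_top] at hbM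
    filter_upwards [ae_le_eLpNormEssSup (f := b) (μ := μ)] with v hv
    exact enorm_le_coe.1 (hv.trans hbM)
  have hbound := hsol.fourier_bound hμ hb2 hh hg₁ hg₀ hFh hF0 hF1
  set u := (innerSL ℂ (realToL2 μ ψ)).compLp Fh with hu
  have hvu := velocityAverage_ae_eq hμ hψ2 hFh
  have hL : MemLp (velocityAverage R h ψ) 2 (volume : Measure (SpaceTime d₁)) :=
    (memLp_congr_ae hvu).2 (Lp.memLp u)
  have hLu : hL.toLp (velocityAverage R h ψ) = u := by
    refine Lp.ext ?_
    exact hL.coeFn_toLp.trans hvu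
  have hpt : ∀ᵐ ζ : SpaceTime d₁, ‖(((1 + ‖ζ‖ ^ 2) ^ (α / (4 + α) / 2) : ℝ) : ℂ) *
      (𝓕 u : Lp ℂ 2 (volume : Measure (SpaceTime d₁))) ζ‖ ≤
      C₀ * P * ‖‖(𝓕 Fh : Lp (Lp ℂ 2 μ) 2 (volume : Measure (SpaceTime d₁))) ζ‖ +
        (‖(𝓕 F0 : Lp (Lp ℂ 2 μ) 2 (volume : Measure (SpaceTime d₁))) ζ‖ +
        ∑ j, ‖(𝓕 (F1 j) : Lp (Lp ℂ 2 μ) 2 (volume : Measure (SpaceTime d₁))) ζ‖)‖ := by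
    rw [hu, fourier_compLp]
    filter_upwards [hbound, (innerSL ℂ (realToL2 μ ψ)).coeFn_compLp (𝓕 Fh)] with ζ h1 h2
    rw [h2, innerSL_apply_apply, norm_mul, Complex.norm_real, Real.norm_of_nonneg (by positivity),
      Real.norm_of_nonneg (by positivity)]
    have hN2 : ‖ζ‖ ^ 2 = ζ.fst ^ 2 + ‖ζ.snd‖ ^ 2 := by
      rw [WithLp.prod_norm_sq_eq_of_L2, Real.norm_eq_abs, sq_abs]
    refine sobolev_weight_mul_le hα (norm_nonneg _) hP0 ha0 hc0.le (by positivity) (norm_nonneg _)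
      ?_ fun hN ε hε hε1 => ?_
    -- The trivial bound uses that the L² norm of ψ is at most P times the root of the volume of the
    -- ball, which a contains as a summand.
    · refine (norm_inner_le_norm _ _).trans (mul_le_mul_of_nonneg_right ?_ (norm_nonneg _))
      rw [norm_realToL2 hψ2]
      refine ENNReal.toReal_le_of_le_ofReal (by positivity) ?_
      refine (eLpNorm_le_of_ae_bound (C := P) (Eventually.of_forall hP)).trans ?_
      rw [mul_comm P, ENNReal.ofReal_mul ha0]
      gcongr
      rw [ha, ← ENNReal.ofReal_toReal (ENNReal.rpow_ne_top_of_nonneg (by norm_num)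
        (measure_ne_top μ univ))]
      refine ENNReal.ofReal_le_ofReal ?_
      rw [← ENNReal.toReal_rpow, Real.sqrt_eq_rpow]
      norm_num [measureReal_def]
    · rw [inner_realToL2 hψ2]
      refine (norm_integral_average_le hμ hK.le hα hα1 Mb.2 hH hbM' hnd hψ hψc hψs hP hP' _
        (norm_nonneg ((𝓕 F0 : Lp (Lp ℂ 2 μ) 2 (volume : Measure (SpaceTime d₁))) ζ))
        (Finset.sum_nonneg (s := Finset.univ) fun j _ =>
          norm_nonneg ((𝓕 (F1 j) : Lp (Lp ℂ 2 μ) 2 (volume : Measure (SpaceTime d₁))) ζ))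
        ζ.fst ζ.snd
        (fun η e1 e2 e3 => ?_) hN hN2 hε hε1).trans ?_
      · rw [Finset.mul_sum]
        exact h1 η e1 e2 e3
      · rw [← hμ] at hDbM
        gcongr
        · rw [ha]
          gcongr
          exact ENNReal.toReal_le_coe_of_le_coe hDbM
        · exact hc.ge
  have hWm : AEStronglyMeasurable (fun ζ : SpaceTime d₁ =>
      (((1 + ‖ζ‖ ^ 2) ^ (α / (4 + α) / 2) : ℝ) : ℂ) *
      (𝓕 u : Lp ℂ 2 (volume : Measure (SpaceTime d₁))) ζ) volume := by
    refine AEStronglyMeasurable.mul (Continuous.aestronglyMeasurable ?_) (Lp.aestronglyMeasurable _)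
    exact Complex.continuous_ofReal.comp ((by fun_prop : Continuous fun ζ : SpaceTime d₁ =>
      1 + ‖ζ‖ ^ 2).rpow_const fun ζ => Or.inl (by positivity))
  have hWn : eLpNorm (fun ζ : SpaceTime d₁ => (((1 + ‖ζ‖ ^ 2) ^ (α / (4 + α) / 2) : ℝ) : ℂ) *
      (𝓕 u : Lp ℂ 2 (volume : Measure (SpaceTime d₁))) ζ) 2 volume ≤
      (Real.toNNReal C₀ * (d₂ + 1) : ℝ≥0) * w1InftyNorm R ψ *
              (eLpNorm h 2 (volume.restrict (phaseDomain d₁ d₂ R)) +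
                eLpNorm g₁ 2 (volume.restrict (phaseDomain d₁ d₂ R)) +
                eLpNorm g₀ 2 (volume.restrict (phaseDomain d₁ d₂ R))) := by
    refine (eLpNorm_le_mul_eLpNorm_of_ae_le_mul hpt 2).trans ?_
    refine (mul_le_mul_right (eLpNorm_add_add_sum_le (𝓕 Fh) (𝓕 F0) fun j => 𝓕 (F1 j)) _).trans ?_
    simp only [enorm_fourier_eq, hFhn, hF0n]
    rw [ENNReal.ofReal_mul hC₀0.le, hPdef, ENNReal.ofReal_toReal hPfin, ENNReal.coe_mul]
    set X := eLpNorm h 2 (volume.restrict (phaseDomain d₁ d₂ R))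
    set Y := eLpNorm g₁ 2 (volume.restrict (phaseDomain d₁ d₂ R))
    set Z := eLpNorm g₀ 2 (volume.restrict (phaseDomain d₁ d₂ R))
    have hsum : ∑ j, ‖F1 j‖ₑ ≤ d₂ * Y := by
      refine (Finset.sum_le_sum fun j _ => hF1n' j).trans ?_
      simp
    calc ENNReal.ofReal C₀ * w1InftyNorm R ψ * (X + (Z + ∑ j, ‖F1 j‖ₑ))
        ≤ ENNReal.ofReal C₀ * w1InftyNorm R ψ * (X + (Z + d₂ * Y)) := by gcongr
      _ ≤ ENNReal.ofReal C₀ * w1InftyNorm R ψ * (((d₂ : ℝ≥0∞) + 1) * (X + Y + Z)) := by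
          gcongr
          calc X + (Z + d₂ * Y) ≤ X + (Z + d₂ * Y) + (d₂ * X + Y + d₂ * Z) := le_self_add
            _ = _ := by ring
      _ = _ := by
          push_cast
          rw [ENNReal.ofReal]
          ring
  obtain ⟨h1, h2⟩ := sobolevNorm_le_of_fourier (α / (4 + α)) u
    ⟨hWm, hWn.trans_lt (ENNReal.mul_lt_top (ENNReal.mul_lt_top ENNReal.coe_lt_top hPfin.lt_top)
      (ENNReal.add_lt_top.2 ⟨ENNReal.add_lt_top.2 ⟨hh.2, hg₁.2⟩, hg₀.2⟩))⟩
  refine ⟨hL, ?_⟩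
  rw [hLu]
  exact ⟨h1, h2.trans hWn⟩
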